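/- Let $M$ be a smooth (Hausdorff, second countable) manifold of dimension $4$, let $f\colon M\to\mathbb{R}^{5}$ be a smooth immersion, and let $\xi\colon M\to\mathbb{R}^5$ be a smooth transversal vector field along $f$, i.e. $\mathbb{R}^5=f_*(T_xM)\oplus\mathbb{R}\,\xi_x$ for every $x\in M$. Let $D$ be the standard flat connection of $\mathbb{R}^5$, and let the induced connection $\nabla$, the second fundamental form $h$, the shape operator $S$ and the transversal connection form $\tau$ be defined by $$D_Xf_*Y=f_*(\nabla_XY)+h(X,Y)\,\xi,\qquad D_X\xi=-f_*(SX)+\tau(X)\,\xi$$ for vector fields $X,Y$ on $M$. Assume that $\xi$ is locally equiaffine, i.e. $d\tau=0$, and that $h$ is non-degenerate and Lorentzian, i.e. has signature $(3,1)$ at every point of $M$. Let $\omega$ be an almost symplectic form on $M$, i.e. a smooth non-degenerate $2$-form (not assumed closed). For a tensor field $T$ of type $(0,p)$ let $\nabla T$ be the tensor field of type $(0,p+1)$ given by $$(\nabla T)(X_1,\ldots,X_{p+1})=X_1\bigl(T(X_2,\ldots,X_{p+1})\bigr)-\sum_{i=2}^{p+1}T(X_2,\ldots,\nabla_{X_1}X_i,\ldots,X_{p+1}),$$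 and put $\nabla^0T=T$, $\nabla^{k+1}T=\nabla(\nabla^kT)$. If $\nabla^k\omega=0$ for some integer $k\ge 1$, then the shape operator $S$ has rank at most $1$ at every point of $M$. -/

import Mathlib

open scoped Manifold ContDiff Bundle Topology

noncomputable section

/-- An immersed hypersurface `f : M → ℝⁿ⁺¹` of an `n`-dimensional smooth manifold, together with a
smooth transversal vector field `ξ` along `f`: `ℝⁿ⁺¹ = f_*(T_x M) ⊕ ℝ ξ_x` at every point `x`. -/
structure AffineHypersurface (n : ℕ) (M : Type*) [TopologicalSpace M]
    [ChartedSpace (EuclideanSpace ℝ (Fin n)) M] [IsManifold (𝓡 n) ∞ M] where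
  /-- The immersion. -/
  f : M → EuclideanSpace ℝ (Fin (n + 1))
  contMDiff_f : ContMDiff (𝓡 n) 𝓘(ℝ, EuclideanSpace ℝ (Fin (n + 1))) ∞ f
  injective_mvfderiv_f : ∀ x, Function.Injective (mvfderiv (𝓡 n) f x)
  /-- The transversal vector field. -/
  ξ : M → EuclideanSpace ℝ (Fin (n + 1))
  contMDiff_ξ : ContMDiff (𝓡 n) 𝓘(ℝ, EuclideanSpace ℝ (Fin (n + 1))) ∞ ξ
  transversal : ∀ x, IsCompl (LinearMap.range (mvfderiv (𝓡 n) f x).toLinearMap)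
    (Submodule.span ℝ {ξ x})

/-- A non-degenerate smooth 2-form on `M`. -/
structure AlmostSymplecticForm (n : ℕ) (M : Type*) [TopologicalSpace M]
    [ChartedSpace (EuclideanSpace ℝ (Fin n)) M] [IsManifold (𝓡 n) ∞ M] where
  /-- The form at each point. -/
  toFun : ∀ x : M, TangentSpace (𝓡 n) x →L[ℝ] TangentSpace (𝓡 n) x →L[ℝ] ℝ
  alternating : ∀ (x : M) (v : TangentSpace (𝓡 n) x), toFun x v v = 0
  nondegenerate : ∀ (x : M) (v : TangentSpace (𝓡 n) x), (∀ w, toFun x v w = 0) → v = 0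
  contMDiff : ContMDiff (𝓡 n)
    ((𝓡 n).prod 𝓘(ℝ, EuclideanSpace ℝ (Fin n) →L[ℝ] EuclideanSpace ℝ (Fin n) →L[ℝ] ℝ)) ∞
    (fun x ↦ Bundle.TotalSpace.mk'
      (EuclideanSpace ℝ (Fin n) →L[ℝ] EuclideanSpace ℝ (Fin n) →L[ℝ] ℝ) x (toFun x))

/-- The vector field `X` on `M` is smooth. -/
def SmoothVectorField {n : ℕ} {M : Type*} [TopologicalSpace M]
    [ChartedSpace (EuclideanSpace ℝ (Fin n)) M] [IsManifold (𝓡 n) ∞ M]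
    (X : ∀ x : M, TangentSpace (𝓡 n) x) : Prop :=
  ContMDiff (𝓡 n) (𝓡 n).tangent ∞
    (fun x ↦ (⟨x, X x⟩ : TangentBundle (𝓡 n) M))

namespace AffineHypersurface

variable {n : ℕ} {M : Type*} [TopologicalSpace M]
  [ChartedSpace (EuclideanSpace ℝ (Fin n)) M] [IsManifold (𝓡 n) ∞ M]
  (D : AffineHypersurface n M)

theorem ξ_ne_zero (x : M) : D.ξ x ≠ 0 := by
  intro h0
  have h := (D.transversal x).sup_eq_top
  rw [h0, Submodule.span_zero_singleton, sup_bot_eq] at h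
  have : FiniteDimensional ℝ (TangentSpace (𝓡 n) x) :=
    inferInstanceAs (FiniteDimensional ℝ (EuclideanSpace ℝ (Fin n)))
  have h1 := LinearMap.finrank_range_le (mvfderiv (𝓡 n) D.f x).toLinearMap
  rw [h, finrank_top, finrank_euclideanSpace_fin] at h1
  have h2 : Module.finrank ℝ (TangentSpace (𝓡 n) x) = n := finrank_euclideanSpace_fin
  omega

/-- The map `(v, a) ↦ f_* v + a ξ_x`. -/
def frameMap (x : M) :
    (TangentSpace (𝓡 n) x × ℝ) →ₗ[ℝ] EuclideanSpace ℝ (Fin (n + 1)) :=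
  (mvfderiv (𝓡 n) D.f x).toLinearMap.coprod (LinearMap.toSpanSingleton ℝ _ (D.ξ x))

theorem frameMap_bijective (x : M) : Function.Bijective (D.frameMap x) := by
  have hr : LinearMap.range (LinearMap.toSpanSingleton ℝ _ (D.ξ x)) = Submodule.span ℝ {D.ξ x} :=
    LinearMap.range_toSpanSingleton _
  constructor
  · rw [← LinearMap.ker_eq_bot, frameMap, LinearMap.ker_coprod_of_disjoint_range]
    · rw [LinearMap.ker_eq_bot.2 (D.injective_mvfderiv_f x),
        LinearMap.ker_toSpanSingleton ℝ (D.ξ_ne_zero x), Submodule.prod_bot]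
    · rw [hr]; exact (D.transversal x).disjoint
  · rw [← LinearMap.range_eq_top, frameMap, LinearMap.range_coprod, hr]
    exact (D.transversal x).sup_eq_top

/-- The decomposition `ℝⁿ⁺¹ = f_*(T_x M) ⊕ ℝ ξ_x`. -/
def splitting (x : M) :
    EuclideanSpace ℝ (Fin (n + 1)) ≃ₗ[ℝ] (TangentSpace (𝓡 n) x × ℝ) :=
  (LinearEquiv.ofBijective (D.frameMap x) (D.frameMap_bijective x)).symm

/-- `u ↦ v`, where `u = f_* v + a ξ_x`. -/
def tangentPart (x : M) : EuclideanSpace ℝ (Fin (n + 1)) →L[ℝ] TangentSpace (𝓡 n) x :=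
  LinearMap.toContinuousLinearMap (LinearMap.fst ℝ _ _ ∘ₗ (D.splitting x).toLinearMap)

/-- `u ↦ a`, where `u = f_* v + a ξ_x`. -/
def transversalPart (x : M) : EuclideanSpace ℝ (Fin (n + 1)) →L[ℝ] ℝ :=
  LinearMap.toContinuousLinearMap (LinearMap.snd ℝ _ _ ∘ₗ (D.splitting x).toLinearMap)

theorem tangentPart_add_transversalPart (x : M) (u : EuclideanSpace ℝ (Fin (n + 1))) :
    mvfderiv (𝓡 n) D.f x (D.tangentPart x u) + D.transversalPart x u • D.ξ x = u :=
  (LinearEquiv.ofBijective (D.frameMap x) (D.frameMap_bijective x)).apply_symm_apply u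

theorem transversalPart_mvfderiv (x : M) (v : TangentSpace (𝓡 n) x) :
    D.transversalPart x (mvfderiv (𝓡 n) D.f x v) = 0 := by
  have h : D.splitting x (mvfderiv (𝓡 n) D.f x v) = (v, 0) := by
    rw [splitting, LinearEquiv.symm_apply_eq]
    simp [frameMap]
  simp [transversalPart, h]

/-- The vector field `f_* Y` along `f`. -/
def pushforward (Y : ∀ x : M, TangentSpace (𝓡 n) x) (x : M) : EuclideanSpace ℝ (Fin (n + 1)) :=
  mvfderiv (𝓡 n) D.f x (Y x)

theorem mdifferentiableAt_pushforward {Y : ∀ x : M, TangentSpace (𝓡 n) x} {x : M}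
    (hY : MDifferentiableAt (𝓡 n) (𝓡 n).tangent
      (fun y ↦ (⟨y, Y y⟩ : TangentBundle (𝓡 n) M)) x) :
    MDifferentiableAt (𝓡 n) 𝓘(ℝ, EuclideanSpace ℝ (Fin (n + 1))) (D.pushforward Y) x := by
  have h1 := (D.contMDiff_f.contMDiff_tangentMap (m := 1)
    (by norm_num; exact ENat.LEInfty.out)).mdifferentiable
    (by norm_num)
  have h2 := (h1 _).comp x hY
  exact (((contMDiff_snd_tangentBundle_modelSpace (n := 1) (EuclideanSpace ℝ (Fin (n + 1)))
    𝓘(ℝ, EuclideanSpace ℝ (Fin (n + 1)))).mdifferentiable one_ne_zero) _).comp x h2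

/-- The induced connection: `(∇_X Y)_x = D.nabla Y x (X x)` is the tangential part
of `D_X f_* Y`. -/
def nabla (Y : ∀ x : M, TangentSpace (𝓡 n) x) (x : M) :
    TangentSpace (𝓡 n) x →L[ℝ] TangentSpace (𝓡 n) x :=
  D.tangentPart x ∘L mvfderiv (𝓡 n) (D.pushforward Y) x

theorem tensorialAt_transversalPart (x : M) :
    TensorialAt (𝓡 n) (EuclideanSpace ℝ (Fin n))
      (fun Y : ∀ x : M, TangentSpace (𝓡 n) x ↦
        D.transversalPart x ∘L mvfderiv (𝓡 n) (D.pushforward Y) x) x where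
  smul := by
    intro g Y hg hY
    have : D.pushforward (g • Y) = g • D.pushforward Y := by
      ext1 y; simp [pushforward]
    simp only [this, mvfderiv_smul hg (D.mdifferentiableAt_pushforward hY)]
    ext v
    simp [pushforward, transversalPart_mvfderiv]
  add := by
    intro Y Z hY hZ
    have : D.pushforward (Y + Z) = D.pushforward Y + D.pushforward Z := by
      ext1 y; simp [pushforward]
    simp only [this, mvfderiv_add (D.mdifferentiableAt_pushforward hY)
      (D.mdifferentiableAt_pushforward hZ)]
    ext v
    simp

/-- The second fundamental form: `D.h x (X x) (Y x)` is the transversal part of `D_X f_* Y`. -/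
def h (x : M) : LinearMap.BilinForm ℝ (TangentSpace (𝓡 n) x) :=
  (ContinuousLinearMap.coeLM ℝ ∘ₗ
    (TensorialAt.mkHom _ x (D.tensorialAt_transversalPart x)).toLinearMap).flip

/-- The shape operator: minus the tangential part of `D_X ξ`. -/
def S (x : M) : TangentSpace (𝓡 n) x →L[ℝ] TangentSpace (𝓡 n) x :=
  -(D.tangentPart x ∘L mvfderiv (𝓡 n) D.ξ x)

/-- The transversal connection form: the transversal part of `D_X ξ`. -/
def τ (x : M) : TangentSpace (𝓡 n) x →L[ℝ] ℝ :=
  D.transversalPart x ∘L mvfderiv (𝓡 n) D.ξ x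

/-- Gauss formula `D_X f_* Y = f_* (∇_X Y) + h(X, Y) ξ`. -/
theorem gauss_formula {X Y : ∀ x : M, TangentSpace (𝓡 n) x} {x : M}
    (hY : MDifferentiableAt (𝓡 n) (𝓡 n).tangent
      (fun y ↦ (⟨y, Y y⟩ : TangentBundle (𝓡 n) M)) x) :
    mvfderiv (𝓡 n) (D.pushforward Y) x (X x) =
      mvfderiv (𝓡 n) D.f x (D.nabla Y x (X x)) + D.h x (X x) (Y x) • D.ξ x := by
  have hh : D.h x (X x) (Y x) =
      D.transversalPart x (mvfderiv (𝓡 n) (D.pushforward Y) x (X x)) :=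
    DFunLike.congr_fun (TensorialAt.mkHom_apply (D.tensorialAt_transversalPart x) hY) (X x)
  rw [hh]
  exact (D.tangentPart_add_transversalPart x _).symm

/-- Weingarten formula `D_X ξ = -f_* (S X) + τ(X) ξ`. -/
theorem weingarten_formula (x : M) (v : TangentSpace (𝓡 n) x) :
    mvfderiv (𝓡 n) D.ξ x v =
      -mvfderiv (𝓡 n) D.f x (D.S x v) + D.τ x v • D.ξ x := by
  have := D.tangentPart_add_transversalPart x (mvfderiv (𝓡 n) D.ξ x v)
  simpa [S, τ] using this.symm

/-- `ξ` is locally equiaffine: `dτ = 0`, that is `X(τ(Y)) - Y(τ(X)) - τ([X, Y]) = 0` for all smooth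
vector fields `X`, `Y`. -/
def IsLocallyEquiaffine : Prop :=
  ∀ X Y : ∀ x : M, TangentSpace (𝓡 n) x, SmoothVectorField X → SmoothVectorField Y → ∀ x : M,
    mvfderiv (𝓡 n) (fun y ↦ D.τ y (Y y)) x (X x) - mvfderiv (𝓡 n) (fun y ↦ D.τ y (X y)) x (Y x)
      - D.τ x (VectorField.mlieBracket (𝓡 n) X Y x) = 0

/-- The hypersurface is non-degenerate. -/
def IsNondegenerate : Prop :=
  ∀ (x : M) (v : TangentSpace (𝓡 n) x), (∀ w, D.h x v w = 0) → v = 0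

/-- The quadratic form `v ↦ h(v, v)` on `T_x M`. -/
def quadraticForm (x : M) : QuadraticForm ℝ (TangentSpace (𝓡 n) x) :=
  LinearMap.BilinMap.toQuadraticMap (D.h x)

/-- The second fundamental form has signature `(n - 1, 1)` at every point. -/
def IsLorentzian : Prop :=
  ∀ x : M, sigPos (D.quadraticForm x) + 1 = n ∧
    sigNeg (D.quadraticForm x) = 1

/-- The covariant derivative of a tensor field `T` of type `(0, p)`, as an operation on vector
fields: `(∇T)(X₀, …, X_p) = X₀(T(X₁, …, X_p)) - ∑ᵢ T(X₁, …, ∇_{X₀} Xᵢ, …, X_p)`. -/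
def nablaTensor {p : ℕ} (T : (Fin p → ∀ x : M, TangentSpace (𝓡 n) x) → M → ℝ)
    (X : Fin (p + 1) → ∀ x : M, TangentSpace (𝓡 n) x) (x : M) : ℝ :=
  mvfderiv (𝓡 n) (T (fun i ↦ X i.succ)) x (X 0 x) -
    ∑ i : Fin p,
      T (Function.update (fun j ↦ X j.succ) i (fun y ↦ D.nabla (X i.succ) y (X 0 y))) x

/-- The iterated covariant derivative: `∇⁰T = T` and `∇ᵏ⁺¹T = ∇(∇ᵏT)`. -/
def iteratedNabla {p : ℕ} (T : (Fin p → ∀ x : M, TangentSpace (𝓡 n) x) → M → ℝ) :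
    (k : ℕ) → (Fin (p + k) → ∀ x : M, TangentSpace (𝓡 n) x) → M → ℝ
  | 0 => T
  | k + 1 => D.nablaTensor (iteratedNabla T k)

end AffineHypersurface

/-- An almost symplectic form as an operation on pairs of vector fields. -/
def AlmostSymplecticForm.onFields {n : ℕ} {M : Type*} [TopologicalSpace M]
    [ChartedSpace (EuclideanSpace ℝ (Fin n)) M] [IsManifold (𝓡 n) ∞ M]
    (Ω : AlmostSymplecticForm n M) (X : Fin 2 → ∀ x : M, TangentSpace (𝓡 n) x) (x : M) : ℝ :=
  Ω.toFun x (X 0 x) (X 1 x)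

end

/-! By the Gauss equation the curvature of ∇ at a point is R(x, y) = Sx ⊗ h(y, ·) − Sy ⊗ h(x, ·),
and dτ = 0 makes S self-adjoint for h. The Ricci identity turns the antisymmetrised second covariant
derivative into the derivation action of R, so Rᵖ · ω is a signed sum of index permutations of ∇²ᵖω.
If ∇ᵏω = 0 then ∇²ᵏω = 0, hence Rᵏ · ω = 0 (`iteratedCurvatureAction_eq_zero`); what remains is
algebra at one point (`finrank_range_shape_le_one`).

Suppose rank S ≥ 2. Totally isotropic subspaces of a Lorentzian space are at most one-dimensional,
so the image of S is not isotropic. The core is `curvatureAction_eq_zero_or`: if R · (R · T) = 0,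
then φ(x, y) = R(x, y) · T is an equivariant tensor-valued 2-form, and computing [R(x, y), R(z, w)]
· T in two ways gives a Kulkarni–Nomizu identity S ∧ φ = h ∧ ψ with ψ(x, w) = φ(Sx, w) + φ(x, Sw).
Contraction yields ψ = cφ with 3c = tr S, so (S − c) ∧ φ = 0. This forces φ = 0, unless S is c ≠ 0
times the projection along a non-null vector e (`eq_zero_or_of_kulkarniNomizu`).

Outside the exceptional case Rᵏ · ω = 0 descends to R · ω = 0, and one more contraction gives S = 0
(`shape_eq_zero_of_curvatureAction_eq_zero`). In the exceptional case R(x, y), for orthogonal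
non-null x, y ⊥ e, is invertible on span(x, y) and zero on its complement, yet must act nilpotently
on ω; this makes a nonzero vector ω-orthogonal to everything
(`iteratedCurvatureAction_ne_zero_of_projection`). -/

namespace AffineCurvature

open Module

/-! ### Linear algebra of the curvature operator and of Kulkarni–Nomizu identities -/

section Pointwise

variable {V W : Type*} [AddCommGroup V] [Module ℝ V] [AddCommGroup W] [Module ℝ W]

/-- The curvature operator `R(x, y) = Sx ⊗ h(y, ·) - Sy ⊗ h(x, ·)` of the Gauss equation. -/
def gaussCurvature (h : LinearMap.BilinForm ℝ V) (S : V →ₗ[ℝ] V) : V →ₗ[ℝ] V →ₗ[ℝ] V →ₗ[ℝ] V :=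
  LinearMap.mk₂ ℝ (fun x y ↦ (h y).smulRight (S x) - (h x).smulRight (S y))
    (fun x x' y ↦ by ext z; simp; module) (fun a x y ↦ by ext z; simp; module)
    (fun x y y' ↦ by ext z; simp; module) (fun a x y ↦ by ext z; simp; module)

@[simp]
theorem gaussCurvature_apply (h : LinearMap.BilinForm ℝ V) (S : V →ₗ[ℝ] V) (x y z : V) :
    gaussCurvature h S x y z = h y z • S x - h x z • S y := by
  simp [gaussCurvature]

theorem gaussCurvature_swap (h : LinearMap.BilinForm ℝ V) (S : V →ₗ[ℝ] V) (x y : V) :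
    gaussCurvature h S x y = -gaussCurvature h S y x := by
  ext z; simp

/-- The commutator of two curvature operators is a combination of curvature operators. -/
theorem gaussCurvature_commutator {h : LinearMap.BilinForm ℝ V} {S : V →ₗ[ℝ] V}
    (hsymm : ∀ x y, h x y = h y x) (hS : ∀ x y, h (S x) y = h x (S y)) (x y z w : V) :
    gaussCurvature h S x y ∘ₗ gaussCurvature h S z w -
      gaussCurvature h S z w ∘ₗ gaussCurvature h S x y =
    h (S y) z • gaussCurvature h S x w + h (S x) w • gaussCurvature h S y z
      - h (S y) w • gaussCurvature h S x z - h (S x) z • gaussCurvature h S y w := by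
  ext u
  have e1 := hS y z
  have e2 := hS x w
  have e3 := hS y w
  have e4 := hS x z
  have f1 : h z (S y) = h (S y) z := hsymm _ _
  have f2 : h w (S x) = h (S x) w := hsymm _ _
  have f3 : h w (S y) = h (S y) w := hsymm _ _
  have f4 : h z (S x) = h (S x) z := hsymm _ _
  simp only [LinearMap.sub_apply, LinearMap.comp_apply, gaussCurvature_apply, LinearMap.add_apply,
    LinearMap.smul_apply, map_sub, map_smul, ← e1, ← e2, ← e3, ← e4, f1, f2, f3, f4]
  module

/-- A basis of a nondegenerate form expands every vector through the form. -/
theorem exists_contraction [FiniteDimensional ℝ V] {h : LinearMap.BilinForm ℝ V}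
    (hsymm : ∀ x y, h x y = h y x) (hnd : ∀ x, (∀ y, h x y = 0) → x = 0) :
    ∃ (v u : Fin (finrank ℝ V) → V), (∀ x, ∑ i, h x (v i) • u i = x) ∧ (∀ i, h (v i) (u i) = 1) ∧
      ∀ i, ∃ a : ℝ, u i = a • v i := by
  obtain ⟨v, hv⟩ := LinearMap.BilinForm.exists_orthogonal_basis (B := h)
    ⟨fun x y ↦ by simp [hsymm y x]⟩
  have hne : ∀ i, h (v i) (v i) ≠ 0 := by
    intro i hi
    refine v.ne_zero i (hnd _ fun y ↦ ?_)
    rw [← v.sum_repr y, map_sum]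
    refine Finset.sum_eq_zero fun j _ ↦ ?_
    rw [map_smul]
    rcases eq_or_ne i j with rfl | hij
    · simp [hi]
    · have : h (v i) (v j) = 0 := hv hij
      simp [this]
  refine ⟨v, fun i ↦ (h (v i) (v i))⁻¹ • v i, fun x ↦ ?_, fun i ↦ by simp [hne i],
    fun i ↦ ⟨_, rfl⟩⟩
  refine sub_eq_zero.1 (hnd _ fun y ↦ ?_)
  rw [← v.sum_repr y, map_sum]
  refine Finset.sum_eq_zero fun j _ ↦ ?_
  rw [map_smul, map_sub, LinearMap.sub_apply, map_sum, LinearMap.sum_apply,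
    Finset.sum_eq_single j]
  · simp [hne j]
  · intro i _ hij
    have : h (v i) (v j) = 0 := hv hij
    simp [this]
  · simp

/-- Contraction of a Kulkarni–Nomizu type identity `s ∧ φ = h ∧ ψ` in dimension four. -/
theorem contract_kulkarniNomizu [FiniteDimensional ℝ V] (dim : finrank ℝ V = 4)
    {h : LinearMap.BilinForm ℝ V} {S : V →ₗ[ℝ] V}
    (hsymm : ∀ x y, h x y = h y x) (hS : ∀ x y, h (S x) y = h x (S y))
    {φ : V →ₗ[ℝ] V →ₗ[ℝ] W} (alt : ∀ x y, φ x y = -φ y x)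
    (kn : ∀ x y z w, h (S y) z • φ x w + h (S x) w • φ y z - h (S y) w • φ x z - h (S x) z • φ y w
      = h y z • (φ (S x) w + φ x (S w)) + h x w • (φ (S y) z + φ y (S z))
        - h y w • (φ (S x) z + φ x (S z)) - h x z • (φ (S y) w + φ y (S w)))
    {v u : Fin (finrank ℝ V) → V} (hvu : ∀ x, ∑ i, h x (v i) • u i = x)
    (hvu1 : ∀ i, h (v i) (u i) = 1) (huv : ∀ i, ∃ a : ℝ, u i = a • v i) (x w : V) :
    (3 : ℝ) • (φ (S x) w + φ x (S w)) = (∑ i, h (S (v i)) (u i)) • φ x w := by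
  have hvu2 : ∀ x, ∑ i, h x (u i) • v i = x := by
    intro x
    conv_rhs => rw [← hvu x]
    refine Finset.sum_congr rfl fun i _ ↦ ?_
    obtain ⟨a, ha⟩ := huv i
    rw [ha, map_smul, smul_smul, smul_eq_mul, mul_comm]
  have self : ∀ y, φ y y = 0 := fun y ↦ by
    have := alt y y
    have h2 : (2 : ℝ) • φ y y = 0 := by rw [two_smul]; nth_rw 1 [this]; simp
    simpa using h2
  have selfS : ∀ i, φ (v i) (u i) = 0 := fun i ↦ by
    obtain ⟨a, ha⟩ := huv i
    rw [ha, map_smul, self, smul_zero]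
  have selfS' : ∀ i, φ (S (v i)) (u i) + φ (v i) (S (u i)) = 0 := fun i ↦ by
    obtain ⟨a, ha⟩ := huv i
    rw [ha, map_smul, map_smul, map_smul, alt (v i)]
    simp
  have C : ∀ (L : V →ₗ[ℝ] W) (x : V), ∑ i, h x (v i) • L (u i) = L x := fun L x ↦ by
    conv_rhs => rw [← hvu x]
    simp
  have C2 : ∀ (L : V →ₗ[ℝ] W) (x : V), ∑ i, h x (u i) • L (v i) = L x := fun L x ↦ by
    conv_rhs => rw [← hvu2 x]
    simp
  have key := Finset.sum_congr (rfl : (Finset.univ : Finset (Fin (finrank ℝ V))) = _)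
    fun i _ ↦ kn x (v i) (u i) w
  simp only [selfS, selfS', hvu1, smul_zero, add_zero, one_smul, Finset.sum_sub_distrib,
    Finset.sum_const, Finset.card_univ, Fintype.card_fin, dim] at key
  have k1 : ∑ i, h (S (v i)) w • φ x (u i) = φ x (S w) := by
    rw [← C (φ x) (S w)]
    exact Finset.sum_congr rfl fun i _ ↦ by rw [hS, hsymm]
  have k2 : ∑ i, h (S x) (u i) • φ (v i) w = φ (S x) w := C2 (φ.flip w) (S x)
  have k3 : ∑ i, h (v i) w • (φ (S x) (u i) + φ x (S (u i))) = φ (S x) w + φ x (S w) := by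
    have := C (φ (S x) + φ x ∘ₗ S) w
    rw [LinearMap.add_apply, LinearMap.comp_apply] at this
    rw [← this]
    exact Finset.sum_congr rfl fun i _ ↦ by rw [hsymm]; simp
  have k4 : ∑ i, h x (u i) • (φ (S (v i)) w + φ (v i) (S w)) = φ (S x) w + φ x (S w) := by
    have := C2 (φ.flip w ∘ₗ S + φ.flip (S w)) x
    simpa using this
  -- With ψ(x, w) = φ(Sx, w) + φ(x, Sw), contracting y with z leaves tr(S)φ − ψ on the left and (4 −
  -- 1 − 1)ψ on the right.
  rw [k1, k2, k3, k4, ← Finset.sum_smul] at key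
  have e4 : (4 : ℕ) • (φ (S x) w + φ x (S w)) = (4 : ℝ) • (φ (S x) w + φ x (S w)) := by
    rw [← Nat.cast_smul_eq_nsmul ℝ]; norm_num
  rw [e4] at key
  linear_combination (norm := module) -key

/-- In dimension four three linear functionals have a common nonzero zero. -/
theorem exists_ne_zero_of_three_functionals [FiniteDimensional ℝ V] (dim : finrank ℝ V = 4)
    (a b c : V →ₗ[ℝ] ℝ) : ∃ z ≠ 0, a z = 0 ∧ b z = 0 ∧ c z = 0 := by
  have hk : LinearMap.ker (LinearMap.pi ![a, b, c]) ≠ ⊥ :=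
    LinearMap.ker_ne_bot_of_finrank_lt (by simp [dim])
  obtain ⟨z, hz, hz0⟩ := Submodule.exists_mem_ne_zero_of_ne_bot hk
  rw [LinearMap.mem_ker] at hz
  exact ⟨z, hz0, congr_fun hz 0, congr_fun hz 1, congr_fun hz 2⟩

/-- An equivariant `2`-form `φ` satisfying a Kulkarni–Nomizu identity vanishes, unless the shape
operator is a multiple of the projection along a non-null vector. -/
theorem eq_zero_or_of_kulkarniNomizu [FiniteDimensional ℝ V] (dim : finrank ℝ V = 4)
    {h : LinearMap.BilinForm ℝ V} {S : V →ₗ[ℝ] V}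
    (hsymm : ∀ x y, h x y = h y x) (hnd : ∀ x, (∀ y, h x y = 0) → x = 0)
    (hS : ∀ x y, h (S x) y = h x (S y)) (hiso : ¬∀ x y, h (S x) (S y) = 0)
    (hrank : ¬∃ e, ∀ x, ∃ a : ℝ, S x = a • e)
    {φ : V →ₗ[ℝ] V →ₗ[ℝ] W} (alt : ∀ x y, φ x y = -φ y x)
    (inv : ∀ x y z, (∀ w, φ z w = 0) → ∀ w, φ (gaussCurvature h S x y z) w = 0)
    (kn : ∀ x y z w, h (S y) z • φ x w + h (S x) w • φ y z - h (S y) w • φ x z - h (S x) z • φ y w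
      = h y z • (φ (S x) w + φ x (S w)) + h x w • (φ (S y) z + φ y (S z))
        - h y w • (φ (S x) z + φ x (S z)) - h x z • (φ (S y) w + φ y (S w))) :
    φ = 0 ∨ ∃ c : ℝ, c ≠ 0 ∧ ∃ e, h e e ≠ 0 ∧ S e = 0 ∧ ∀ z, h e z = 0 → S z = c • z := by
  obtain ⟨v, u, hvu, hvu1, huv⟩ := exists_contraction hsymm hnd
  have hc3 := contract_kulkarniNomizu dim hsymm hS alt kn hvu hvu1 huv
  obtain ⟨c, hc⟩ : ∃ c : ℝ, ∑ i, h (S (v i)) (u i) = 3 * c :=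
    ⟨_, (mul_div_cancel₀ _ three_ne_zero).symm⟩
  have hψ : ∀ x w, φ (S x) w + φ x (S w) = c • φ x w := fun x w ↦ by
    have := hc3 x w
    rw [hc, mul_smul] at this
    exact smul_right_injective W (three_ne_zero (α := ℝ)) this
  -- Since ψ = cφ, the right side of `kn` is c times h ∧ φ and is absorbed by replacing S with N = S
  -- − c. Then tr N = 3c − 4c = −c.
  set N : V →ₗ[ℝ] V := S - c • LinearMap.id with hN
  have hNS : ∀ x, S x = N x + c • x := fun x ↦ by simp [hN]
  have hNsa : ∀ x y, h (N x) y = h (N y) x := fun x y ↦ by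
    simp only [hN, LinearMap.sub_apply, LinearMap.smul_apply, LinearMap.id_apply, map_sub, map_smul,
      hS, hsymm x y, hsymm x (S y)]
  -- the Kulkarni–Nomizu product of `N` and `φ` vanishes
  have hB : ∀ x y z w, h (N y) z • φ x w + h (N x) w • φ y z - h (N y) w • φ x z
      - h (N x) z • φ y w = 0 := fun x y z w ↦ by
    have := kn x y z w
    simp only [hψ] at this
    simp only [hN, LinearMap.sub_apply, LinearMap.smul_apply, LinearMap.id_apply, map_sub, map_smul,
      smul_eq_mul]
    linear_combination (norm := module) this
  by_cases hφ : φ = 0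
  · exact .inl hφ
  right
  have hdim3 : ∑ i, h (N (v i)) (u i) = -c := by
    simp only [hN, LinearMap.sub_apply, LinearMap.smul_apply, LinearMap.id_apply, map_sub, map_smul,
      smul_eq_mul, hvu1, Finset.sum_sub_distrib, hc, Finset.sum_const, Finset.card_univ,
      Fintype.card_fin, dim]
    norm_num
    ring
  obtain ⟨x₀, hx₀⟩ : ∃ x, h (N x) x ≠ 0 := by
    by_contra! hcon
    have hN0 : ∀ x y, h (N x) y = 0 := fun x y ↦ by
      have := hcon (x + y)
      simp only [map_add, LinearMap.add_apply, hcon, hNsa y x] at this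
      linarith
    have hc0 : c = 0 := by simpa [hN0] using hdim3.symm
    refine hrank ⟨0, fun x ↦ ⟨0, ?_⟩⟩
    rw [hNS, hc0, hnd _ (hN0 x)]
    simp
  set β := h (N x₀) x₀ with hβ
  have self : ∀ y, φ y y = 0 := fun y ↦ by
    have := alt y y
    have h2 : (2 : ℝ) • φ y y = 0 := by rw [two_smul]; nth_rw 1 [this]; simp
    simpa using h2
  -- φ is decomposable: up to the factor β it is the wedge of h(Nx₀, ·) with φ(x₀, ·).
  have hφb : ∀ y z, β • φ y z = h (N x₀) y • φ x₀ z - h (N x₀) z • φ x₀ y := fun y z ↦ by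
    have := hB x₀ y z x₀
    rw [self, alt y x₀, hNsa y x₀] at this
    linear_combination (norm := module) this
  have hker : ∀ y z, h (N x₀) y = 0 → h (N x₀) z = 0 → φ y z = 0 := fun y z hy hz ↦ by
    have := hφb y z
    rw [hy, hz] at this
    simpa [hx₀] using this
  have hBker : ∀ y z w, h (N x₀) y = 0 → h (N x₀) z = 0 → h (N x₀) w = 0 →
      h (N y) z • φ x₀ w = h (N y) w • φ x₀ z := fun y z w hy hz hw ↦ by
    have := hB x₀ y z w
    rw [hz, hw] at this
    linear_combination (norm := module) this
  -- The dichotomy is whether the quadratic form of N vanishes on the hyperplane (Nx₀)^⊥. If it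
  -- does, N = S − c has rank one, which is the exceptional case.
  by_cases hcase : ∀ y, h (N x₀) y = 0 → h (N y) y = 0
  · -- `N` has rank one
    have hpol : ∀ y z, h (N x₀) y = 0 → h (N x₀) z = 0 → h (N y) z = 0 := fun y z hy hz ↦ by
      have := hcase (y + z) (by simp [hy, hz])
      simp only [map_add, LinearMap.add_apply, hcase y hy, hcase z hz, hNsa z y] at this
      linarith
    -- βy − h(Nx₀, y)x₀ is β times the projection of y to (Nx₀)^⊥ along x₀, so `hpol` applies to
    -- arbitrary y and z.
    have hN1 : ∀ y, β • N y = h (N x₀) y • N x₀ := fun y ↦ by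
      refine sub_eq_zero.1 (hnd _ fun z ↦ ?_)
      have := hpol (β • y - h (N x₀) y • x₀) (β • z - h (N x₀) z • x₀)
        (by simp [← hβ]; ring) (by simp [← hβ]; ring)
      simp only [map_sub, map_smul, LinearMap.sub_apply, LinearMap.smul_apply, smul_eq_mul,
        ← hβ, hNsa y x₀] at this ⊢
      refine mul_left_cancel₀ hx₀ ?_
      linear_combination this
    have hN2 : ∀ y, N y = (h (N x₀) y / β) • N x₀ := fun y ↦ by
      rw [div_eq_inv_mul, mul_smul, ← hN1, inv_smul_smul₀ hx₀]
    have hc0 : c ≠ 0 := by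
      intro hc0
      exact hrank ⟨N x₀, fun x ↦ ⟨_, by rw [hNS, hc0, zero_smul, add_zero]; exact hN2 x⟩⟩
    -- The trace of the rank one map N is h(Nx₀, Nx₀)/β, and it equals −c. Hence Nx₀ is non-null and
    -- N is −c times the projection onto it.
    have hee : h (N x₀) (N x₀) = -c * β := by
      rw [← hdim3, Finset.sum_mul]
      conv_lhs => enter [2]; rw [← hvu (N x₀)]
      rw [map_sum]
      refine Finset.sum_congr rfl fun i _ ↦ ?_
      have := congr_arg (fun t ↦ h t (u i)) (hN1 (v i))
      simp only [map_smul, LinearMap.smul_apply, smul_eq_mul] at this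
      rw [map_smul, smul_eq_mul, ← this, mul_comm]
    refine ⟨c, hc0, N x₀, by rw [hee]; exact mul_ne_zero (neg_ne_zero.2 hc0) hx₀, ?_, fun z hz ↦ ?_⟩
    · rw [hNS, hN2, hee, mul_div_assoc, div_self hx₀]
      module
    · rw [hNS, hN2, hz]
      simp
  · exfalso
    push Not at hcase
    obtain ⟨y₀, hy₀, hy₀'⟩ := hcase
    have ht : φ x₀ y₀ ≠ 0 := by
      intro ht
      refine hφ (LinearMap.ext₂ fun y z ↦ ?_)
      have hθ : ∀ w, h (N x₀) w = 0 → φ x₀ w = 0 := fun w hw ↦ by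
        have := hBker y₀ y₀ w hy₀ hy₀ hw
        rw [ht] at this
        simpa [hy₀'] using this
      have hθ' : ∀ w, φ x₀ w = 0 := fun w ↦ by
        have := hθ (β • w - h (N x₀) w • x₀) (by simp [← hβ]; ring)
        simpa [self, hx₀] using this
      have := hφb y z
      simpa [hθ', hx₀] using this
    -- the radical of `φ` is cut out by two functionals
    have hrad : ∀ z, h (N x₀) z = 0 → h (N y₀) z = 0 → ∀ w, φ z w = 0 := fun z hz hz' w ↦ by
      have h1 : φ x₀ z = 0 := by
        have := hBker y₀ y₀ z hy₀ hy₀ hz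
        rw [hz'] at this
        simpa [hy₀'] using this
      have := hφb z w
      rw [hz, h1] at this
      simpa [hx₀] using this
    -- In dimension four some nonzero z lies in the radical of φ and is orthogonal to x. Then R(x,
    -- y)z = h(y, z)Sx, and invariance of the radical puts Sx in it.
    have hSrad : ∀ x w, φ (S x) w = 0 := fun x w ↦ by
      obtain ⟨z, hz0, hz1, hz2, hz3⟩ :=
        exists_ne_zero_of_three_functionals dim (h (N x₀)) (h (N y₀)) (h x)
      obtain ⟨y, hy⟩ : ∃ y, h z y ≠ 0 := by
        by_contra! hcon
        exact hz0 (hnd z hcon)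
      have := inv x y z (hrad z hz1 hz2) w
      rw [gaussCurvature_apply, hz3, hsymm y z] at this
      simpa [hy] using this
    have hc0 : c = 0 := by
      have := hψ x₀ y₀
      rw [hSrad, alt, hSrad, neg_zero, zero_add] at this
      exact (smul_eq_zero.1 this.symm).resolve_right ht
    -- With c = 0 the relations for N become relations for S. Since φ(x₀, y₀) ≠ 0, they make the
    -- image of S totally isotropic, against `hiso`.
    have hSN : ∀ x, S x = N x := fun x ↦ by rw [hNS, hc0]; simp
    have h1 : ∀ x, φ x₀ (S x) = 0 := fun x ↦ by rw [alt, hSrad, neg_zero]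
    have h2 : ∀ x, h (N x₀) (S x) = 0 := fun x ↦ by
      have := hφb (S x) y₀
      rw [hSrad, hy₀, h1] at this
      simpa [ht] using this.symm
    refine hiso fun x y ↦ ?_
    have h3 : ∀ x, h (N y₀) (S x) = 0 := fun x ↦ by
      have := hBker y₀ y₀ (S x) hy₀ hy₀ (h2 x)
      rw [h1] at this
      simpa [ht] using this.symm
    have h4 : ∀ w, h (N x₀) w = 0 → h (N w) (S x) = 0 := fun w hw ↦ by
      have := hBker w (S x) y₀ hw (h2 x) hy₀
      rw [h1] at this
      simpa [ht] using this
    have := h4 (β • y - h (N x₀) y • x₀) (by simp [← hβ]; ring)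
    rw [hsymm, hSN y]
    simpa [h2, hx₀] using this

end Pointwise

/-! ### Endomorphisms and curvature acting on covariant tensors as derivations -/

section Tensors

variable {V : Type*} [AddCommGroup V] [Module ℝ V] {q : ℕ}

/-- The action of an endomorphism on covariant tensors as a derivation. -/
def derivationAction (A : V →ₗ[ℝ] V) (T : MultilinearMap ℝ (fun _ : Fin q ↦ V) ℝ) :
    MultilinearMap ℝ (fun _ : Fin q ↦ V) ℝ :=
  -∑ i, T.compLinearMap (Function.update (fun _ ↦ LinearMap.id) i A)

theorem derivationAction_apply (A : V →ₗ[ℝ] V) (T : MultilinearMap ℝ (fun _ : Fin q ↦ V) ℝ)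
    (Z : Fin q → V) :
    derivationAction A T Z = -∑ i, T (Function.update Z i (A (Z i))) := by
  simp only [derivationAction, neg_apply, sum_apply,
    MultilinearMap.compLinearMap_apply]
  congr 1
  refine Finset.sum_congr rfl fun i _ ↦ congr_arg T (funext fun j ↦ ?_)
  rcases eq_or_ne j i with rfl | hij <;> simp [*]

theorem derivationAction_add_left (A B : V →ₗ[ℝ] V)
    (T : MultilinearMap ℝ (fun _ : Fin q ↦ V) ℝ) :
    derivationAction (A + B) T = derivationAction A T + derivationAction B T := by
  ext Z
  simp [derivationAction_apply, Finset.sum_add_distrib]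
  ring

theorem derivationAction_smul_left (a : ℝ) (A : V →ₗ[ℝ] V)
    (T : MultilinearMap ℝ (fun _ : Fin q ↦ V) ℝ) :
    derivationAction (a • A) T = a • derivationAction A T := by
  ext Z
  simp [derivationAction_apply, Finset.mul_sum]

/-- The action as a linear map in both arguments. -/
def derivationActionₗ : (V →ₗ[ℝ] V) →ₗ[ℝ] MultilinearMap ℝ (fun _ : Fin q ↦ V) ℝ →ₗ[ℝ]
    MultilinearMap ℝ (fun _ : Fin q ↦ V) ℝ :=
  LinearMap.mk₂ ℝ derivationAction derivationAction_add_left derivationAction_smul_left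
    (fun A T T' ↦ by ext Z; simp [derivationAction_apply, Finset.sum_add_distrib]; ring)
    (fun a A T ↦ by ext Z; simp [derivationAction_apply, Finset.mul_sum])

@[simp]
theorem derivationActionₗ_apply (A : V →ₗ[ℝ] V) (T : MultilinearMap ℝ (fun _ : Fin q ↦ V) ℝ) :
    derivationActionₗ A T = derivationAction A T := rfl

/-- Terms where A and B hit different slots are symmetric in A, B and cancel. When both hit the same
slot the order reverses to B ∘ A, and the minus sign in `derivationAction` restores a Lie algebra
representation. -/
theorem derivationAction_commutator (A B : V →ₗ[ℝ] V)
    (T : MultilinearMap ℝ (fun _ : Fin q ↦ V) ℝ) :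
    derivationAction A (derivationAction B T) - derivationAction B (derivationAction A T) =
      derivationAction (A ∘ₗ B - B ∘ₗ A) T := by
  ext Z
  have key : ∀ A B : V →ₗ[ℝ] V, derivationAction A (derivationAction B T) Z =
      (∑ i, ∑ j, if i = j then 0 else
        T (Function.update (Function.update Z i (A (Z i))) j (B (Z j))))
      + ∑ i, T (Function.update Z i (B (A (Z i)))) := by
    intro A B
    simp only [derivationAction_apply, Finset.sum_neg_distrib, neg_neg]
    rw [← Finset.sum_add_distrib]
    refine Finset.sum_congr rfl fun i _ ↦ ?_
    rw [← Finset.add_sum_erase _ _ (Finset.mem_univ i),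
      ← Finset.add_sum_erase (a := i) _ (fun j ↦ if i = j then _ else _) (Finset.mem_univ i)]
    simp only [Function.update_self, Function.update_idem, if_true, zero_add]
    rw [add_comm]
    congr 1
    refine Finset.sum_congr rfl fun j hj ↦ ?_
    have hji : j ≠ i := (Finset.mem_erase.1 hj).1
    rw [if_neg hji.symm, Function.update_of_ne hji]
  rw [sub_apply, key A B, key B A, derivationAction_apply]
  have hs : (∑ i, ∑ j, if i = j then 0 else
        T (Function.update (Function.update Z i (A (Z i))) j (B (Z j)))) =
      ∑ i, ∑ j, if i = j then 0 else
        T (Function.update (Function.update Z i (B (Z i))) j (A (Z j))) := by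
    rw [Finset.sum_comm]
    refine Finset.sum_congr rfl fun i _ ↦ Finset.sum_congr rfl fun j _ ↦ ?_
    rcases eq_or_ne i j with rfl | hij
    · simp
    · rw [if_neg hij, if_neg hij.symm, Function.update_comm hij]
  rw [hs]
  simp [Finset.sum_sub_distrib]

variable (h : LinearMap.BilinForm ℝ V) (S : V →ₗ[ℝ] V)

/-- The tensor `R · T`. -/
def curvatureAction (T : MultilinearMap ℝ (fun _ : Fin q ↦ V) ℝ) :
    MultilinearMap ℝ (fun _ : Fin (q + 1 + 1) ↦ V) ℝ :=
  LinearMap.uncurryLeft (M := fun _ : Fin (q + 1 + 1) ↦ V)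
    ((multilinearCurryLeftEquiv ℝ (fun _ : Fin (q + 1) ↦ V) ℝ).symm.toLinearMap ∘ₗ
      (LinearMap.llcomp ℝ V _ _ (derivationActionₗ.flip T) ∘ₗ gaussCurvature h S))

theorem curvatureAction_cons (T : MultilinearMap ℝ (fun _ : Fin q ↦ V) ℝ) (x y : V)
    (Z : Fin q → V) :
    curvatureAction h S T (Fin.cons x (Fin.cons y Z)) =
      derivationAction (gaussCurvature h S x y) T Z := by
  simp [curvatureAction]

theorem curvatureAction_apply (T : MultilinearMap ℝ (fun _ : Fin q ↦ V) ℝ)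
    (Z : Fin (q + 1 + 1) → V) :
    curvatureAction h S T Z =
      derivationAction (gaussCurvature h S (Z 0) (Z 1)) T (fun i ↦ Z i.succ.succ) := by
  rw [← curvatureAction_cons]
  congr 1
  ext i
  refine Fin.cases ?_ (fun j ↦ Fin.cases ?_ (fun k ↦ ?_) j) i <;> simp

theorem derivationAction_cons_cons (A : V →ₗ[ℝ] V)
    (T : MultilinearMap ℝ (fun _ : Fin (q + 1 + 1) ↦ V) ℝ) (x y : V) (Z : Fin q → V) :
    derivationAction A T (Fin.cons x (Fin.cons y Z)) =
      -T (Fin.cons (A x) (Fin.cons y Z)) - T (Fin.cons x (Fin.cons (A y) Z))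
        - ∑ i, T (Fin.cons x (Fin.cons y (Function.update Z i (A (Z i))))) := by
  rw [derivationAction_apply, Fin.sum_univ_succ, Fin.sum_univ_succ]
  simp only [Fin.cons_zero, Fin.cons_succ, Fin.update_cons_zero, ← Fin.cons_update]
  ring

end Tensors

/-! ### Descent from R · (R · T) = 0, and the equation R · Ω = 0 -/

section Tensors

variable {V : Type*} [AddCommGroup V] [Module ℝ V] {q : ℕ}

/-- If `R · (R · T) = 0` then `R · T = 0`, unless the shape operator is a multiple of the
projection along a non-null vector. -/
theorem curvatureAction_eq_zero_or [FiniteDimensional ℝ V] (dim : finrank ℝ V = 4)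
    {h : LinearMap.BilinForm ℝ V} {S : V →ₗ[ℝ] V}
    (hsymm : ∀ x y, h x y = h y x) (hnd : ∀ x, (∀ y, h x y = 0) → x = 0)
    (hS : ∀ x y, h (S x) y = h x (S y)) (hiso : ¬∀ x y, h (S x) (S y) = 0)
    (hrank : ¬∃ e, ∀ x, ∃ a : ℝ, S x = a • e)
    {T : MultilinearMap ℝ (fun _ : Fin q ↦ V) ℝ}
    (hT : curvatureAction h S (curvatureAction h S T) = 0) :
    curvatureAction h S T = 0 ∨
      ∃ c : ℝ, c ≠ 0 ∧ ∃ e, h e e ≠ 0 ∧ S e = 0 ∧ ∀ z, h e z = 0 → S z = c • z := by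
  set φ : V →ₗ[ℝ] V →ₗ[ℝ] MultilinearMap ℝ (fun _ : Fin q ↦ V) ℝ :=
    LinearMap.llcomp ℝ V _ _ (derivationActionₗ.flip T) ∘ₗ gaussCurvature h S with hφ
  have φ_apply : ∀ x y, φ x y = derivationAction (gaussCurvature h S x y) T := fun x y ↦ by
    simp [hφ]
  -- This is R · (R · T) = 0 evaluated at x, y, z, w: the derivation hits the two form slots or the
  -- slots of T.
  have equivariant : ∀ x y z w, derivationAction (gaussCurvature h S x y) (φ z w) =
      φ (gaussCurvature h S x y z) w + φ z (gaussCurvature h S x y w) := fun x y z w ↦ by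
    ext Z
    have := congr_arg (fun U ↦ U (Fin.cons x (Fin.cons y (Fin.cons z (Fin.cons w Z))))) hT
    simp only [curvatureAction_cons, derivationAction_cons_cons, ← φ_apply, zero_apply] at this
    rw [derivationAction_apply, add_apply]
    linear_combination this
  have alt : ∀ x y, φ x y = -φ y x := fun x y ↦ by
    rw [φ_apply, φ_apply, gaussCurvature_swap, ← derivationActionₗ_apply, map_neg]
    rfl
  -- The commutator of R(x, y) and R(z, w) acting on T is computed once from
  -- `gaussCurvature_commutator` and once from equivariance of φ.
  have kn : ∀ x y z w,
      h (S y) z • φ x w + h (S x) w • φ y z - h (S y) w • φ x z - h (S x) z • φ y w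
      = h y z • (φ (S x) w + φ x (S w)) + h x w • (φ (S y) z + φ y (S z))
        - h y w • (φ (S x) z + φ x (S z)) - h x z • (φ (S y) w + φ y (S w)) := fun x y z w ↦ by
    have key := derivationAction_commutator (gaussCurvature h S x y) (gaussCurvature h S z w) T
    rw [gaussCurvature_commutator hsymm hS, ← φ_apply, ← φ_apply, equivariant, equivariant,
      ← derivationActionₗ_apply] at key
    simp only [map_add, map_sub, map_smul, LinearMap.add_apply, LinearMap.sub_apply,
      LinearMap.smul_apply, derivationActionₗ_apply, ← φ_apply, gaussCurvature_apply] at key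
    rw [hsymm w x, hsymm z x, hsymm w y, hsymm z y, alt z (S x), alt z (S y), alt (S z) y,
      alt (S w) y] at key
    rw [← key]
    module
  have inv : ∀ x y z, (∀ w, φ z w = 0) → ∀ w, φ (gaussCurvature h S x y z) w = 0 :=
    fun x y z hz w ↦ by
      have := equivariant x y z w
      rw [hz, hz, add_zero, ← derivationActionₗ_apply, map_zero] at this
      exact this.symm
  refine (eq_zero_or_of_kulkarniNomizu dim hsymm hnd hS hiso hrank alt inv kn).imp_left fun h0 ↦ ?_
  ext Z
  rw [curvatureAction_apply, ← φ_apply, h0]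
  rfl

/-- A bilinear form as a multilinear map. -/
def tensorOfBilin (Ω : V →ₗ[ℝ] V →ₗ[ℝ] ℝ) : MultilinearMap ℝ (fun _ : Fin 2 ↦ V) ℝ where
  toFun Z := Ω (Z 0) (Z 1)
  map_update_add' Z i x y := by fin_cases i <;> simp
  map_update_smul' Z i a x := by fin_cases i <;> simp

@[simp]
theorem tensorOfBilin_apply (Ω : V →ₗ[ℝ] V →ₗ[ℝ] ℝ) (Z : Fin 2 → V) :
    tensorOfBilin Ω Z = Ω (Z 0) (Z 1) := rfl

theorem derivationAction_apply_two (A : V →ₗ[ℝ] V) (T : MultilinearMap ℝ (fun _ : Fin 2 ↦ V) ℝ)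
    (x y : V) : derivationAction A T ![x, y] = -T ![A x, y] - T ![x, A y] := by
  rw [derivationAction_apply, Fin.sum_univ_two]
  have h1 : Function.update ![x, y] 0 (A x) = ![A x, y] := by
    ext i; fin_cases i <;> simp
  have h2 : Function.update ![x, y] 1 (A y) = ![x, A y] := by
    ext i; fin_cases i <;> simp
  simp only [Matrix.cons_val_zero, Matrix.cons_val_one, h1, h2]
  ring

/-- A nondegenerate form with `R · Ω = 0` forces the shape operator to vanish. -/
theorem shape_eq_zero_of_curvatureAction_eq_zero [FiniteDimensional ℝ V] (dim : finrank ℝ V = 4)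
    {h : LinearMap.BilinForm ℝ V} {S : V →ₗ[ℝ] V}
    (hsymm : ∀ x y, h x y = h y x) (hnd : ∀ x, (∀ y, h x y = 0) → x = 0)
    (hS : ∀ x y, h (S x) y = h x (S y)) {Ω : V →ₗ[ℝ] V →ₗ[ℝ] ℝ}
    (Ωalt : ∀ x, Ω x x = 0) (Ωnd : ∀ x, (∀ y, Ω x y = 0) → x = 0)
    (hΩ : curvatureAction h S (tensorOfBilin Ω) = 0) : S = 0 := by
  obtain ⟨v, u, hvu, hvu1, huv⟩ := exists_contraction hsymm hnd
  have skew : ∀ x y, Ω x y = -Ω y x := fun x y ↦ by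
    have := Ωalt (x + y)
    simp only [map_add, LinearMap.add_apply, Ωalt] at this
    linarith
  have key : ∀ x y z w, h y z * Ω (S x) w - h x z * Ω (S y) w + h y w * Ω z (S x)
      - h x w * Ω z (S y) = 0 := fun x y z w ↦ by
    have := congr_arg (fun U ↦ U (Fin.cons x (Fin.cons y ![z, w]))) hΩ
    simp only [curvatureAction_cons, derivationAction_apply_two, zero_apply] at this
    simp only [tensorOfBilin_apply, gaussCurvature_apply, Matrix.cons_val_zero,
      Matrix.cons_val_one, map_sub, map_smul, LinearMap.sub_apply, LinearMap.smul_apply,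
      smul_eq_mul] at this
    linarith
  obtain ⟨k, hk⟩ : ∃ k, k = ∑ i, Ω (u i) (S (v i)) := ⟨_, rfl⟩
  have hvu2 : ∀ x, ∑ i, h x (u i) • v i = x := by
    intro x
    conv_rhs => rw [← hvu x]
    refine Finset.sum_congr rfl fun i _ ↦ ?_
    obtain ⟨a, ha⟩ := huv i
    rw [ha, map_smul, smul_smul, smul_eq_mul, mul_comm]
  -- Contracting y with z turns the terms of `key` into 4, −1 and −1 times Ω(Sx, w), which is the
  -- factor 2, and −k h(x, w).
  have contr : ∀ x w, 2 * Ω (S x) w = k * h x w := fun x w ↦ by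
    have hs := Finset.sum_congr (rfl : (Finset.univ : Finset (Fin (finrank ℝ V))) = _)
      fun i _ ↦ key x (v i) (u i) w
    simp only [hvu1, one_mul, Finset.sum_sub_distrib, Finset.sum_add_distrib, ← Finset.mul_sum,
      Finset.sum_const_zero, ← hk, Finset.sum_const, Finset.card_univ, Fintype.card_fin, dim] at hs
    have k1 : ∑ i, h x (u i) * Ω (S (v i)) w = Ω (S x) w := by
      conv_rhs => rw [← hvu2 x]
      simp
    have k2 : ∑ i, h (v i) w * Ω (u i) (S x) = Ω w (S x) := by
      conv_rhs => rw [← hvu w]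
      simp [hsymm w]
    rw [k1, k2, skew w (S x)] at hs
    simp only [nsmul_eq_mul, Nat.cast_ofNat] at hs
    linarith
  -- For w = Sy in `contr`, the left side is skew in x, y and the right side symmetric by
  -- self-adjointness, so both vanish.
  have hks : ∀ x y, k * h x (S y) = 0 := fun x y ↦ by
    have h1 := contr (x + y) (S (x + y))
    have h2 := contr x (S x)
    have h3 := contr y (S y)
    simp only [map_add, LinearMap.add_apply, Ωalt, skew (S y) (S x)] at h1 h2 h3
    have := hS y x
    rw [hsymm] at this
    rw [← this] at h1
    linarith
  ext x
  refine Ωnd _ fun w ↦ ?_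
  rcases eq_or_ne k 0 with hk0 | hk0
  · have := contr x w
    rw [hk0] at this
    linarith
  · have : S x = 0 := hnd _ fun y ↦ by
      rw [hsymm]
      simpa [hk0] using hks y x
    simp [this]

/-- The iterated tensors `Rᵖ · Ω`. -/
def iteratedCurvatureAction (h : LinearMap.BilinForm ℝ V) (S : V →ₗ[ℝ] V)
    (T : MultilinearMap ℝ (fun _ : Fin q ↦ V) ℝ) :
    (p : ℕ) → MultilinearMap ℝ (fun _ : Fin (q + 2 * p) ↦ V) ℝ
  | 0 => T
  | p + 1 => curvatureAction h S (iteratedCurvatureAction h S T p)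

/-- A curvature operator `A = R(x, y)` with `A · (x ∧ y) = 0` acts nilpotently. -/
theorem iterate_derivationAction_eq_zero {h : LinearMap.BilinForm ℝ V} {S : V →ₗ[ℝ] V} {x y : V}
    {a b : ℝ} (hx : gaussCurvature h S x y x = a • y) (hy : gaussCurvature h S x y y = b • x)
    (T : MultilinearMap ℝ (fun _ : Fin q ↦ V) ℝ) (p j : ℕ)
    (hT : (derivationAction (gaussCurvature h S x y))^[j] (iteratedCurvatureAction h S T p) = 0) :
    (derivationAction (gaussCurvature h S x y))^[j + p] T = 0 := by
  induction p generalizing j with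
  | zero => exact hT
  | succ p ih =>
    rw [← add_assoc, add_right_comm]
    refine ih (j + 1) ?_
    set A := gaussCurvature h S x y with hA
    set U := iteratedCurvatureAction h S T p
    -- Iterating A keeps the first two slots skew. As Ax is a multiple of y and Ay a multiple of x,
    -- inserting x, y there kills the terms in which A hits these slots, so one factor of R is
    -- traded for one more application of A.
    have claim : ∀ j, (∀ z w Z, (derivationAction A)^[j] (curvatureAction h S U)
          (Fin.cons z (Fin.cons w Z)) = -(derivationAction A)^[j] (curvatureAction h S U)
          (Fin.cons w (Fin.cons z Z))) ∧
        ∀ Z, (derivationAction A)^[j] (curvatureAction h S U) (Fin.cons x (Fin.cons y Z)) =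
          (derivationAction A)^[j + 1] U Z := by
      intro j
      induction j with
      | zero =>
        refine ⟨fun z w Z ↦ ?_, fun Z ↦ ?_⟩
        · simp only [Function.iterate_zero, id_eq, curvatureAction_cons]
          rw [gaussCurvature_swap, ← derivationActionₗ_apply, map_neg]
          rfl
        · simp only [Function.iterate_zero, id_eq, curvatureAction_cons, zero_add,
            Function.iterate_one, ← hA]
      | succ j ihj =>
        obtain ⟨ih1, ih2⟩ := ihj
        rw [Function.iterate_succ_apply']
        refine ⟨fun z w Z ↦ ?_, fun Z ↦ ?_⟩
        · simp only [derivationAction_cons_cons, ih1 (A z) w, ih1 z (A w), ih1 z w,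
            Finset.sum_neg_distrib]
          ring
        · have self : ∀ z Z, (derivationAction A)^[j] (curvatureAction h S U)
              (Fin.cons z (Fin.cons z Z)) = 0 := fun z Z ↦ by
            have := ih1 z z Z
            linarith
          rw [Function.iterate_succ_apply' _ (j + 1),
            derivationAction_cons_cons, derivationAction_apply, hx, hy]
          have e1 : (derivationAction A)^[j] (curvatureAction h S U)
              (Fin.cons (a • y) (Fin.cons y Z)) = 0 := by
            have := ((derivationAction A)^[j] (curvatureAction h S U)).cons_smul
              (Fin.cons y Z) a y
            rw [this, self, smul_zero]
          have e2 : (derivationAction A)^[j] (curvatureAction h S U)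
              (Fin.cons x (Fin.cons (b • x) Z)) = 0 := by
            rw [ih1]
            have := ((derivationAction A)^[j] (curvatureAction h S U)).cons_smul
              (Fin.cons x Z) b x
            rw [this, self, smul_zero, neg_zero]
          rw [e1, e2]
          simp only [ih2]
          ring
    ext Z
    rw [← (claim j).2, show curvatureAction h S U = iteratedCurvatureAction h S T (p + 1) from rfl,
      hT]
    rfl

end Tensors

/-! ### The exceptional shape operator and the pointwise theorem -/

section Tensors

variable {V : Type*} [AddCommGroup V] [Module ℝ V]

theorem iterate_derivationAction_apply_two_of_apply_eq_zero {A : V →ₗ[ℝ] V} {z : V} (hz : A z = 0)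
    (T : MultilinearMap ℝ (fun _ : Fin 2 ↦ V) ℝ) (j : ℕ) (x : V) :
    (derivationAction A)^[j] T ![x, z] = (-1) ^ j * T ![(A ^ j) x, z] := by
  induction j generalizing T x with
  | zero => simp
  | succ j ih =>
    rw [Function.iterate_succ_apply, ih, derivationAction_apply_two, hz, pow_succ' A]
    have : T ![(A ^ j) x, 0] = 0 := T.map_coord_zero 1 rfl
    rw [this]
    simp [pow_succ]

/-- If the shape operator is a multiple of the projection along a non-null vector, then no
nondegenerate form satisfies `Rᵖ · Ω = 0`. -/
theorem iteratedCurvatureAction_ne_zero_of_projection [FiniteDimensional ℝ V]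
    (dim : finrank ℝ V = 4) {h : LinearMap.BilinForm ℝ V} {S : V →ₗ[ℝ] V}
    (hsymm : ∀ x y, h x y = h y x) (hnd : ∀ x, (∀ y, h x y = 0) → x = 0)
    {c : ℝ} (hc : c ≠ 0) {e : V} (he : h e e ≠ 0) (hSc : ∀ z, h e z = 0 → S z = c • z)
    {Ω : V →ₗ[ℝ] V →ₗ[ℝ] ℝ} (Ωalt : ∀ x, Ω x x = 0) (Ωnd : ∀ x, (∀ y, Ω x y = 0) → x = 0)
    (p : ℕ) : iteratedCurvatureAction h S (tensorOfBilin Ω) p ≠ 0 := by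
  intro hp
  have claim : ∀ x y z, h e x = 0 → h e y = 0 → h x y = 0 → h x x ≠ 0 → h y y ≠ 0 →
      h x z = 0 → h y z = 0 → Ω x z = 0 := by
    intro x y z hx hy hxy hxx hyy hxz hyz
    set A := gaussCurvature h S x y with hA
    have hAx : A x = (-(c * h x x)) • y := by
      simp only [hA, gaussCurvature_apply, hSc x hx, hSc y hy, hsymm y x, hxy]
      module
    have hAy : A y = (c * h y y) • x := by
      simp only [hA, gaussCurvature_apply, hSc x hx, hSc y hy, hxy]
      module
    have hAz : A z = 0 := by simp [hA, hxz, hyz]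
    have h0 := iterate_derivationAction_eq_zero hAx hAy (tensorOfBilin Ω) p 0 hp
    -- The iteration count is padded to 2p because A² is the scalar d on span(x, y), so that A²ᵖx =
    -- dᵖx with d ≠ 0.
    have h1 : (derivationAction A)^[p + (0 + p)] (tensorOfBilin Ω) = 0 := by
      rw [Function.iterate_add_apply, h0]
      exact Function.iterate_fixed (map_zero (derivationActionₗ A)) p
    have h2 := congr_arg (fun U ↦ U ![x, z]) h1
    simp only [iterate_derivationAction_apply_two_of_apply_eq_zero hAz] at h2
    set d := -(c * h x x) * (c * h y y) with hd
    have hd0 : d ≠ 0 := mul_ne_zero (neg_ne_zero.2 (mul_ne_zero hc hxx)) (mul_ne_zero hc hyy)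
    have hpow : ∀ k, (A ^ (k + (0 + k))) x = d ^ k • x := fun k ↦ by
      induction k with
      | zero => simp
      | succ k ih =>
        rw [show k + 1 + (0 + (k + 1)) = (k + (0 + k)) + 2 by ring, pow_add, Module.End.mul_apply,
          pow_two, Module.End.mul_apply, hAx, map_smul, hAy, smul_smul, ← hd, map_smul, ih,
          smul_smul, pow_succ']
    rw [hpow] at h2
    simpa [hd0] using h2
  set K := h.orthogonal (Submodule.span ℝ {e}) with hK
  have hmem : ∀ x : K, h e x = 0 := fun x ↦
    (LinearMap.BilinForm.mem_orthogonal_iff.1 x.2) e (Submodule.mem_span_singleton_self e)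
  have hrefl : h.IsRefl := fun x y hxy ↦ by rw [hsymm]; exact hxy
  have hnd' : h.Nondegenerate :=
    ⟨fun x hx ↦ hnd x hx, fun x hx ↦ hnd x fun y ↦ by rw [hsymm]; exact hx y⟩
  have hKnd := h.restrict_nondegenerate_orthogonal_spanSingleton hnd' hrefl he
  have hcompl := LinearMap.BilinForm.isCompl_span_singleton_orthogonal he
  have hKdim : finrank ℝ K = 3 := by
    have h1 : finrank ℝ (Submodule.span ℝ {e}) + finrank ℝ K = finrank ℝ V :=
      Submodule.finrank_add_eq_of_isCompl hcompl
    rw [finrank_span_singleton (by rintro rfl; simp at he), dim] at h1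
    omega
  obtain ⟨v, hv⟩ : ∃ v : Basis (Fin 3) ℝ K, (h.restrict K).IsOrthoᵢ v :=
    hKdim ▸ LinearMap.BilinForm.exists_orthogonal_basis (B := h.restrict K)
      ⟨fun x y ↦ by simp [hsymm y x]⟩
  have hne : ∀ i, h (v i) (v i) ≠ 0 :=
    fun i ↦ LinearMap.BilinForm.iIsOrtho.not_isOrtho_basis_self_of_nondegenerate hv hKnd i
  have hort : ∀ i j, i ≠ j → h (v i) (v j) = 0 := fun i j hij ↦ hv hij
  have hve : ∀ i, h (v i) e = 0 := fun i ↦ by rw [hsymm]; exact hmem _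
  -- The second argument of `claim` is always a basis vector of e^⊥ other than the one tested, which
  -- makes v 0 Ω-orthogonal to all of v 1, v 2 and e.
  have h01 : Ω (v 0) (v 1) = 0 := claim (v 0) (v 2) (v 1) (hmem _) (hmem _) (hort _ _ (by decide))
    (hne _) (hne _) (hort _ _ (by decide)) (hort _ _ (by decide))
  have h02 : Ω (v 0) (v 2) = 0 := claim (v 0) (v 1) (v 2) (hmem _) (hmem _) (hort _ _ (by decide))
    (hne _) (hne _) (hort _ _ (by decide)) (hort _ _ (by decide))
  have h0e : Ω (v 0) e = 0 := claim (v 0) (v 1) e (hmem _) (hmem _) (hort _ _ (by decide))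
    (hne _) (hne _) (hve _) (hve _)
  have hv0 : (v 0 : V) = 0 := by
    refine Ωnd _ fun y ↦ ?_
    obtain ⟨a, ha, k, hk, rfl⟩ := Submodule.mem_sup.1
      (hcompl.sup_eq_top ▸ Submodule.mem_top : y ∈ Submodule.span ℝ {e} ⊔ K)
    obtain ⟨t, rfl⟩ := Submodule.mem_span_singleton.1 ha
    have hrepr := congr_arg (Ω (v 0) ∘ₗ K.subtype) (v.sum_repr ⟨k, hk⟩)
    simp only [Fin.sum_univ_three, map_add, map_smul, LinearMap.comp_apply, Submodule.subtype_apply,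
      h01, h02, Ωalt, smul_zero, add_zero] at hrepr
    rw [map_add, map_smul, h0e, ← hrepr]
    simp
  exact v.ne_zero 0 (Subtype.ext hv0)

theorem finrank_range_shape_le_one [FiniteDimensional ℝ V]
    (dim : finrank ℝ V = 4) {h : LinearMap.BilinForm ℝ V} {S : V →ₗ[ℝ] V}
    (hsymm : ∀ x y, h x y = h y x) (hnd : ∀ x, (∀ y, h x y = 0) → x = 0)
    (hS : ∀ x y, h (S x) y = h x (S y))
    (hpos : sigPos (LinearMap.BilinMap.toQuadraticMap h) = 3)
    {Ω : V →ₗ[ℝ] V →ₗ[ℝ] ℝ} (Ωalt : ∀ x, Ω x x = 0) (Ωnd : ∀ x, (∀ y, Ω x y = 0) → x = 0)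
    (p : ℕ) (hp : iteratedCurvatureAction h S (tensorOfBilin Ω) p = 0) :
    finrank ℝ (LinearMap.range S) ≤ 1 := by
  by_contra hcon
  have hrank : ¬∃ e, ∀ x, ∃ a : ℝ, S x = a • e := by
    rintro ⟨e, he⟩
    refine hcon ?_
    have hle : LinearMap.range S ≤ Submodule.span ℝ {e} := by
      rintro _ ⟨x, rfl⟩
      obtain ⟨a, ha⟩ := he x
      exact Submodule.mem_span_singleton.2 ⟨a, ha.symm⟩
    exact (Submodule.finrank_mono hle).trans (finrank_span_le_card _ |>.trans (by simp))
  -- This is where the signature enters: an isotropic image satisfies 3 + rank S ≤ 4.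
  have hiso : ¬∀ x y, h (S x) (S y) = 0 := by
    intro h0
    have := QuadraticForm.sigPos_add_finrank_le_of_nonpos (Q := LinearMap.BilinMap.toQuadraticMap h)
      (V := LinearMap.range S) (by rintro _ ⟨x, rfl⟩; simp [h0])
    omega
  by_cases hproj : ∃ c : ℝ, c ≠ 0 ∧ ∃ e, h e e ≠ 0 ∧ S e = 0 ∧ ∀ z, h e z = 0 → S z = c • z
  · obtain ⟨c, hc, e, he, -, hSc⟩ := hproj
    exact iteratedCurvatureAction_ne_zero_of_projection dim hsymm hnd hc he hSc Ωalt Ωnd p hp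
  have hS0 : S ≠ 0 := by
    rintro rfl
    exact hrank ⟨0, fun x ↦ ⟨0, by simp⟩⟩
  have hRΩ : curvatureAction h S (tensorOfBilin Ω) ≠ 0 := fun h0 ↦
    hS0 (shape_eq_zero_of_curvatureAction_eq_zero dim hsymm hnd hS Ωalt Ωnd h0)
  -- The exceptional case being excluded, a vanishing power of R on Ω would propagate down to R · Ω
  -- = 0.
  have hne : ∀ p, iteratedCurvatureAction h S (tensorOfBilin Ω) (p + 1) ≠ 0 := by
    intro p
    induction p with
    | zero => exact hRΩ
    | succ p ih =>
      intro h0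
      exact ih ((curvatureAction_eq_zero_or dim hsymm hnd hS hiso hrank h0).resolve_right hproj)
  refine hne p ?_
  rw [iteratedCurvatureAction, hp]
  ext Z
  simp [curvatureAction_apply, derivationAction_apply]

end Tensors

end AffineCurvature

open Bundle VectorField

/-! ### Smooth vector fields and the Lie bracket as a commutator of derivations -/

section Fields

variable {n : ℕ} {M : Type*} [TopologicalSpace M]
  [ChartedSpace (EuclideanSpace ℝ (Fin n)) M] [IsManifold (𝓡 n) ∞ M]
  {F : Type*} [NormedAddCommGroup F] [NormedSpace ℝ F]

theorem exists_smoothVectorField_eq [T2Space M] (x : M) (v : TangentSpace (𝓡 n) x) :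
    ∃ X : ∀ y : M, TangentSpace (𝓡 n) y, SmoothVectorField X ∧ X x = v := by
  obtain ⟨s, hs, hsX⟩ := FiberBundle.exists_contMDiffOn_extend (k := ∞) (𝓡 n)
    (EuclideanSpace ℝ (Fin n)) v
  obtain ⟨ψ, -, hψ⟩ := (SmoothBumpFunction.nhds_basis_tsupport (I := 𝓡 n) x).mem_iff.1
    (interior_mem_nhds.2 hs)
  refine ⟨(ψ : M → ℝ) • FiberBundle.extend (EuclideanSpace ℝ (Fin n)) v, ?_, ?_⟩
  · exact ContMDiffOn.smul_section_of_tsupport ψ.contMDiff.contMDiffOn isOpen_interior hψ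
      (hsX.mono interior_subset)
  · simp

namespace SmoothVectorField

variable {X Y : ∀ x : M, TangentSpace (𝓡 n) x}

theorem sub (hX : SmoothVectorField X) (hY : SmoothVectorField Y) : SmoothVectorField (X - Y) :=
  ContMDiff.sub_section hX hY

theorem neg (hX : SmoothVectorField X) : SmoothVectorField (-X) :=
  ContMDiff.neg_section hX

theorem smul {g : M → ℝ} (hg : ContMDiff (𝓡 n) 𝓘(ℝ, ℝ) ∞ g) (hX : SmoothVectorField X) :
    SmoothVectorField (fun x ↦ g x • X x) :=
  ContMDiff.smul_section hg hX

theorem mdifferentiableAt (hX : SmoothVectorField X) (x : M) :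
    MDifferentiableAt (𝓡 n) (𝓡 n).tangent (fun y ↦ (⟨y, X y⟩ : TangentBundle (𝓡 n) M)) x :=
  (hX x).mdifferentiableAt (by simp)

end SmoothVectorField

theorem ContMDiff.mvfderiv_apply_smoothVectorField {g : M → F} (hg : ContMDiff (𝓡 n) 𝓘(ℝ, F) ∞ g)
    {X : ∀ x : M, TangentSpace (𝓡 n) x} (hX : SmoothVectorField X) :
    ContMDiff (𝓡 n) 𝓘(ℝ, F) ∞ (fun x ↦ mvfderiv (𝓡 n) g x (X x)) := by
  have h1 := hg.contMDiff_tangentMap (m := ∞) le_rfl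
  exact (contMDiff_snd_tangentBundle_modelSpace (n := ∞) F 𝓘(ℝ, F)).comp (h1.comp hX)

/-- In the chart around `x` the derivative of a function is the Fréchet derivative. -/
theorem mvfderiv_eq_fderiv_chart {g : M → F} (hg : ContMDiff (𝓡 n) 𝓘(ℝ, F) ∞ g) {x y : M}
    (hy : y ∈ (extChartAt (𝓡 n) x).source) (v : TangentSpace (𝓡 n) y) :
    mvfderiv (𝓡 n) g y v = fderiv ℝ (g ∘ (extChartAt (𝓡 n) x).symm) (extChartAt (𝓡 n) x y)
      (mfderiv (𝓡 n) 𝓘(ℝ, EuclideanSpace ℝ (Fin n)) (extChartAt (𝓡 n) x) y v) := by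
  set φ := extChartAt (𝓡 n) x with hφ
  have hy' : φ y ∈ φ.target := φ.map_source hy
  have hev : g =ᶠ[𝓝 y] (g ∘ φ.symm) ∘ φ := by
    filter_upwards [extChartAt_source_mem_nhds' hy] with z hz
    simp [φ.left_inv hz]
  have hd : MDifferentiableAt 𝓘(ℝ, EuclideanSpace ℝ (Fin n)) 𝓘(ℝ, F) (g ∘ φ.symm) (φ y) := by
    have h1 := contMDiffWithinAt_extChartAt_symm_range (n := ∞) (I := 𝓡 n) x hy'
    have h2 := (hg _).comp_contMDiffWithinAt _ h1
    rw [(𝓡 n).range_eq_univ, contMDiffWithinAt_univ] at h2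
    exact h2.mdifferentiableAt (by simp)
  have hφd : MDifferentiableAt (𝓡 n) 𝓘(ℝ, EuclideanSpace ℝ (Fin n)) φ y :=
    mdifferentiableAt_extChartAt (by rwa [← extChartAt_source (𝓡 n)])
  have h3 : mfderiv (𝓡 n) 𝓘(ℝ, F) g y = mfderiv (𝓡 n) 𝓘(ℝ, F) ((g ∘ φ.symm) ∘ φ) y :=
    hev.mfderiv_eq
  have h4 := mfderiv_comp_apply y hd hφd v
  rw [mfderiv_eq_fderiv] at h4
  exact (congr_arg (fun L ↦ L v) h3).trans h4

omit [IsManifold (𝓡 n) ∞ M] in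
theorem contDiffAt_comp_extChartAt_symm {g : M → F} (hg : ContMDiff (𝓡 n) 𝓘(ℝ, F) ∞ g) (x : M) :
    ContDiffAt ℝ ∞ (g ∘ (extChartAt (𝓡 n) x).symm) (extChartAt (𝓡 n) x x) := by
  have h1 := contMDiffWithinAt_extChartAt_symm_range_self (n := ∞) (I := 𝓡 n) x
  have h2 := (hg _).comp_contMDiffWithinAt _ h1
  rw [(𝓡 n).range_eq_univ, contMDiffWithinAt_univ] at h2
  exact h2.contDiffAt

/-- The Lie bracket acts on vector valued functions as the commutator. -/
theorem mvfderiv_mlieBracket {g : M → F} (hg : ContMDiff (𝓡 n) 𝓘(ℝ, F) ∞ g)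
    {X Y : ∀ x : M, TangentSpace (𝓡 n) x} (hX : SmoothVectorField X) (hY : SmoothVectorField Y)
    (x : M) :
    mvfderiv (𝓡 n) g x (mlieBracket (𝓡 n) X Y x) =
      mvfderiv (𝓡 n) (fun y ↦ mvfderiv (𝓡 n) g y (Y y)) x (X x) -
        mvfderiv (𝓡 n) (fun y ↦ mvfderiv (𝓡 n) g y (X y)) x (Y x) := by
  set φ := extChartAt (𝓡 n) x with hφ
  have hx : x ∈ φ.source := mem_extChartAt_source x
  -- C Z is the coordinate expression of Z in the chart at x. It reduces the claim to the Fréchet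
  -- formula, which rests on the symmetry of second derivatives.
  let C : (∀ x : M, TangentSpace (𝓡 n) x) → EuclideanSpace ℝ (Fin n) → EuclideanSpace ℝ (Fin n) :=
    fun Z ↦ mpullbackWithin 𝓘(ℝ, EuclideanSpace ℝ (Fin n)) (𝓡 n) φ.symm Z (Set.range (𝓡 n))
  have hC : ∀ Z, ∀ y ∈ φ.source, C Z (φ y) =
      mfderiv (𝓡 n) 𝓘(ℝ, EuclideanSpace ℝ (Fin n)) φ y (Z y) := fun Z y hy ↦ by
    have h1 : C Z (φ y) = (mfderivWithin 𝓘(ℝ, EuclideanSpace ℝ (Fin n)) (𝓡 n) φ.symm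
        (Set.range (𝓡 n)) (φ y)).inverse (Z (φ.symm (φ y))) := rfl
    have h2 : (mfderivWithin 𝓘(ℝ, EuclideanSpace ℝ (Fin n)) (𝓡 n) φ.symm
        (Set.range (𝓡 n)) (φ y)).inverse = mfderiv (𝓡 n) 𝓘(ℝ, EuclideanSpace ℝ (Fin n)) φ y := by
      refine ContinuousLinearMap.inverse_eq ?_ ?_
      · exact mfderivWithin_extChartAt_symm_comp_mfderiv_extChartAt' hy
      · exact mfderiv_extChartAt_comp_mfderivWithin_extChartAt_symm' hy
    rw [h1, h2]
    have h3 : (Z (φ.symm (φ y)) : EuclideanSpace ℝ (Fin n)) = Z y :=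
      congr_arg (fun z ↦ (Z z : EuclideanSpace ℝ (Fin n))) (φ.left_inv hy)
    exact congr_arg (fun z : EuclideanSpace ℝ (Fin n) ↦
      mfderiv (𝓡 n) 𝓘(ℝ, EuclideanSpace ℝ (Fin n)) φ y z) h3
  have hCd : ∀ Z, SmoothVectorField Z → DifferentiableAt ℝ (C Z) (φ x) := fun Z hZ ↦ by
    have h1 := contMDiffWithinAt_mpullbackWithin_extChartAt_symm (n := ∞) (m := 1)
      ((hZ x).of_le (by norm_num)).contMDiffWithinAt uniqueMDiffOn_univ (Set.mem_univ x)
      (by norm_num; exact ENat.LEInfty.out)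
    rw [contMDiffWithinAt_vectorSpace_iff_contDiffWithinAt, Set.preimage_univ,
      Set.inter_univ] at h1
    exact (h1.contDiffAt (extChartAt_target_mem_nhds (I := 𝓡 n) x)).differentiableAt one_ne_zero
  have hder : ∀ Z, SmoothVectorField Z → ∀ v,
      mvfderiv (𝓡 n) (fun y ↦ mvfderiv (𝓡 n) g y (Z y)) x v =
      fderiv ℝ (fun e ↦ fderiv ℝ (g ∘ φ.symm) e (C Z e)) (φ x)
        (mfderiv (𝓡 n) 𝓘(ℝ, EuclideanSpace ℝ (Fin n)) φ x v) := fun Z hZ v ↦ by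
    rw [mvfderiv_eq_fderiv_chart (hg.mvfderiv_apply_smoothVectorField hZ) hx]
    congr 1
    refine Filter.EventuallyEq.fderiv_eq ?_
    filter_upwards [extChartAt_target_mem_nhds (I := 𝓡 n) x] with e he
    have he' : φ.symm e ∈ φ.source := φ.map_target he
    rw [Function.comp_apply, mvfderiv_eq_fderiv_chart hg he', ← hC Z _ he', φ.right_inv he]
  rw [hder Y hY, hder X hX, ← hC X x hx, ← hC Y x hx,
    ← fderiv_apply_lieBracket (contDiffAt_comp_extChartAt_symm hg x)
      (by norm_num; exact ENat.LEInfty.out)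
      (hCd Y hY) (hCd X hX), mvfderiv_eq_fderiv_chart hg hx]
  congr 1
  have h1 : mlieBracket (𝓡 n) X Y x = lieBracket ℝ (C X) (C Y) (φ x) := by
    -- Tangent spaces are modelled through the preferred chart, so the derivative of the chart at
    -- its own base point is the identity.
    have hid : ∀ w : EuclideanSpace ℝ (Fin n), (mfderiv (𝓡 n) 𝓘(ℝ, EuclideanSpace ℝ (Fin n))
        (extChartAt (𝓡 n) x) x).inverse w = w := fun w ↦ by
      have e : mfderiv (𝓡 n) 𝓘(ℝ, EuclideanSpace ℝ (Fin n)) (extChartAt (𝓡 n) x) x =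
        ContinuousLinearMap.id ℝ (EuclideanSpace ℝ (Fin n)) := mfderiv_extChartAt_self
      exact (congr_arg (fun L : EuclideanSpace ℝ (Fin n) →L[ℝ] EuclideanSpace ℝ (Fin n) ↦
        L.inverse w) e).trans (by rw [ContinuousLinearMap.inverse_id]; rfl)
    refine (hid _).trans ?_
    change lieBracketWithin ℝ (C X) (C Y) ((extChartAt (𝓡 n) x).symm ⁻¹' Set.univ ∩
      Set.range (𝓡 n)) (φ x) = _
    rw [Set.preimage_univ, Set.univ_inter, (𝓡 n).range_eq_univ, lieBracketWithin_univ]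
  rw [h1, hφ, mfderiv_extChartAt_self]
  rfl

end Fields

/-! ### Smoothness of the splitting into tangential and transversal parts -/

namespace AffineHypersurface

variable {n : ℕ} {M : Type*} [TopologicalSpace M]
  [ChartedSpace (EuclideanSpace ℝ (Fin n)) M] [IsManifold (𝓡 n) ∞ M]
  (D : AffineHypersurface n M)

theorem tangentPart_mvfderiv (x : M) (v : TangentSpace (𝓡 n) x) :
    D.tangentPart x (mvfderiv (𝓡 n) D.f x v) = v := by
  have h : D.splitting x (mvfderiv (𝓡 n) D.f x v) = (v, 0) := by
    rw [splitting, LinearEquiv.symm_apply_eq]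
    simp [frameMap]
  simp [tangentPart, h]

theorem splitting_ξ (x : M) : D.splitting x (D.ξ x) = (0, 1) := by
  rw [splitting, LinearEquiv.symm_apply_eq]
  simp [frameMap]

@[simp]
theorem tangentPart_ξ (x : M) : D.tangentPart x (D.ξ x) = 0 := by
  simp [tangentPart, D.splitting_ξ]

@[simp]
theorem transversalPart_ξ (x : M) : D.transversalPart x (D.ξ x) = 1 := by
  simp [transversalPart, D.splitting_ξ]

/-- In chart coordinates `frameMap` is a smooth family Φ of invertible operators, and inversion of
operators is smooth. -/
theorem contMDiffAt_tangentPart_transversalPart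
    {u : M → EuclideanSpace ℝ (Fin (n + 1))}
    (hu : ContMDiff (𝓡 n) 𝓘(ℝ, EuclideanSpace ℝ (Fin (n + 1))) ∞ u) (x : M) :
    ContMDiffAt (𝓡 n) 𝓘(ℝ, EuclideanSpace ℝ (Fin n) × ℝ) ∞
      (fun y ↦ ((trivializationAt (EuclideanSpace ℝ (Fin n)) (TangentSpace (𝓡 n)) x
        ⟨y, D.tangentPart y (u y)⟩).2, D.transversalPart y (u y))) x := by
  set φ := extChartAt (𝓡 n) x with hφ
  let A : M → EuclideanSpace ℝ (Fin n) →L[ℝ] EuclideanSpace ℝ (Fin (n + 1)) :=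
    inTangentCoordinates (𝓡 n) 𝓘(ℝ, EuclideanSpace ℝ (Fin (n + 1))) id D.f
      (mfderiv (𝓡 n) 𝓘(ℝ, EuclideanSpace ℝ (Fin (n + 1))) D.f) x
  have hA : ContMDiffAt (𝓡 n)
      𝓘(ℝ, EuclideanSpace ℝ (Fin n) →L[ℝ] EuclideanSpace ℝ (Fin (n + 1))) ∞ A x :=
    (D.contMDiff_f x).mfderiv_const (m := ∞) le_rfl
  have hAeq : ∀ y ∈ φ.source, ∀ v : TangentSpace (𝓡 n) y,
      A y (mfderiv (𝓡 n) 𝓘(ℝ, EuclideanSpace ℝ (Fin n)) φ y v) = mvfderiv (𝓡 n) D.f y v := by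
    intro y hy v
    have h1 : A y = _ := inTangentCoordinates_eq_mfderiv_comp (f := id) (g := D.f)
      (by simpa [hφ] using hy)
      (by rw [chartAt_self_eq]; trivial)
    rw [h1]
    have h2 := mfderivWithin_extChartAt_symm_comp_mfderiv_extChartAt' hy
    have h3 := congr_arg (fun L ↦ mvfderiv (𝓡 n) D.f y (L v)) h2
    have h4 : ∀ w : EuclideanSpace ℝ (Fin (n + 1)),
        mfderiv 𝓘(ℝ, EuclideanSpace ℝ (Fin (n + 1))) 𝓘(ℝ, EuclideanSpace ℝ (Fin (n + 1)))
        (extChartAt 𝓘(ℝ, EuclideanSpace ℝ (Fin (n + 1))) (D.f (id x))) (D.f y) w = w := fun w ↦ by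
      rw [extChartAt_model_space_eq_id, PartialEquiv.refl_coe, mfderiv_id]
      rfl
    exact (h4 _).trans h3
  let Φ : M → (EuclideanSpace ℝ (Fin n) × ℝ) →L[ℝ] EuclideanSpace ℝ (Fin (n + 1)) :=
    fun y ↦ A y ∘L ContinuousLinearMap.fst ℝ _ _ +
      ContinuousLinearMap.smulRightL ℝ (EuclideanSpace ℝ (Fin n) × ℝ)
        (EuclideanSpace ℝ (Fin (n + 1)))
        (ContinuousLinearMap.snd ℝ (EuclideanSpace ℝ (Fin n)) ℝ) (D.ξ y)
  have hΦ : ContMDiffAt (𝓡 n)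
      𝓘(ℝ, (EuclideanSpace ℝ (Fin n) × ℝ) →L[ℝ] EuclideanSpace ℝ (Fin (n + 1))) ∞ Φ x :=
    (hA.clm_comp contMDiffAt_const).add
      ((ContinuousLinearMap.contMDiff _).contMDiffAt.comp x (D.contMDiff_ξ x))
  have hsurj : ∀ y ∈ φ.source, ∀ e : EuclideanSpace ℝ (Fin n), ∃ v : TangentSpace (𝓡 n) y,
      mfderiv (𝓡 n) 𝓘(ℝ, EuclideanSpace ℝ (Fin n)) φ y v = e := fun y hy e ↦
    (isInvertible_mfderiv_extChartAt hy).bijective.2 e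
  have hΦeq : ∀ y ∈ φ.source, ∀ (v : TangentSpace (𝓡 n) y) (a : ℝ),
      Φ y (mfderiv (𝓡 n) 𝓘(ℝ, EuclideanSpace ℝ (Fin n)) φ y v, a) = D.frameMap y (v, a) := by
    intro y hy v a
    rw [frameMap, LinearMap.coprod_apply]
    exact congr_arg (· + a • D.ξ y) (hAeq y hy v)
  have hinv : ∀ y ∈ φ.source, (Φ y).IsInvertible := by
    intro y hy
    have hb : Function.Bijective (Φ y) := by
      refine ⟨(injective_iff_map_eq_zero _).2 ?_, fun w ↦ ?_⟩
      · rintro ⟨e, a⟩ h0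
        obtain ⟨v, rfl⟩ := hsurj y hy e
        rw [hΦeq y hy] at h0
        have := (D.frameMap_bijective y).1 (h0.trans (map_zero _).symm)
        rw [Prod.mk_eq_zero] at this
        rw [this.1, this.2, map_zero]
        rfl
      · obtain ⟨⟨v, a⟩, h0⟩ := (D.frameMap_bijective y).2 w
        exact ⟨_, (hΦeq y hy v a).trans h0⟩
    exact ⟨ContinuousLinearEquiv.ofBijective (Φ y) (LinearMap.ker_eq_bot.2 hb.1)
      (LinearMap.range_eq_top.2 hb.2), ContinuousLinearEquiv.coe_ofBijective _ _ _⟩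
  have hev : ∀ y ∈ φ.source, ((trivializationAt (EuclideanSpace ℝ (Fin n)) (TangentSpace (𝓡 n)) x
        ⟨y, D.tangentPart y (u y)⟩).2, D.transversalPart y (u y)) = (Φ y).inverse (u y) := by
    intro y hy
    rw [eq_comm, (hinv y hy).inverse_apply_eq]
    have h1 : (trivializationAt (EuclideanSpace ℝ (Fin n)) (TangentSpace (𝓡 n)) x
        ⟨y, D.tangentPart y (u y)⟩).2 =
        mfderiv (𝓡 n) 𝓘(ℝ, EuclideanSpace ℝ (Fin n)) φ y (D.tangentPart y (u y)) := by
      have hy' : y ∈ (chartAt (EuclideanSpace ℝ (Fin n)) x).source := by simpa [hφ] using hy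
      rw [hφ, ← TangentBundle.continuousLinearMapAt_trivializationAt hy']
      exact (Bundle.Trivialization.continuousLinearMapAt_apply_of_mem (R := ℝ) _
        (by simpa using hy') _).symm
    rw [h1, hΦeq y hy]
    exact (D.tangentPart_add_transversalPart y (u y)).symm
  have hx : x ∈ φ.source := mem_extChartAt_source x
  refine ContMDiffAt.congr_of_eventuallyEq (f := fun y ↦ (Φ y).inverse (u y)) ?_ ?_
  · refine ContMDiffAt.clm_apply ?_ (hu x)
    exact ((hinv x hx).contDiffAt_map_inverse).contMDiffAt.comp x hΦ
  · filter_upwards [extChartAt_source_mem_nhds (I := 𝓡 n) x] with y hy using hev y hy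

theorem smoothVectorField_tangentPart
    {u : M → EuclideanSpace ℝ (Fin (n + 1))}
    (hu : ContMDiff (𝓡 n) 𝓘(ℝ, EuclideanSpace ℝ (Fin (n + 1))) ∞ u) :
    SmoothVectorField (fun y ↦ D.tangentPart y (u y)) := fun x ↦ by
  rw [contMDiffAt_section]
  exact (ContinuousLinearMap.fst ℝ (EuclideanSpace ℝ (Fin n)) ℝ).contMDiff.contMDiffAt.comp x
    (D.contMDiffAt_tangentPart_transversalPart hu x)

theorem contMDiff_transversalPart
    {u : M → EuclideanSpace ℝ (Fin (n + 1))}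
    (hu : ContMDiff (𝓡 n) 𝓘(ℝ, EuclideanSpace ℝ (Fin (n + 1))) ∞ u) :
    ContMDiff (𝓡 n) 𝓘(ℝ, ℝ) ∞ (fun y ↦ D.transversalPart y (u y)) := fun x ↦ by
  have h := (ContinuousLinearMap.snd ℝ (EuclideanSpace ℝ (Fin n)) ℝ).contMDiff (n := ∞)
    |>.contMDiffAt.comp x (D.contMDiffAt_tangentPart_transversalPart hu x)
  exact h

end AffineHypersurface

open AffineCurvature

/-! ### Structure equations of the hypersurface -/

namespace AffineHypersurface

variable {n : ℕ} {M : Type*} [TopologicalSpace M]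
  [ChartedSpace (EuclideanSpace ℝ (Fin n)) M] [IsManifold (𝓡 n) ∞ M]
  (D : AffineHypersurface n M) {X Y Z : ∀ x : M, TangentSpace (𝓡 n) x}

theorem contMDiff_pushforward (hY : SmoothVectorField Y) :
    ContMDiff (𝓡 n) 𝓘(ℝ, EuclideanSpace ℝ (Fin (n + 1))) ∞ (D.pushforward Y) :=
  D.contMDiff_f.mvfderiv_apply_smoothVectorField hY

theorem smoothVectorField_nabla (hX : SmoothVectorField X) (hY : SmoothVectorField Y) :
    SmoothVectorField (fun y ↦ D.nabla Y y (X y)) :=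
  D.smoothVectorField_tangentPart
    ((D.contMDiff_pushforward hY).mvfderiv_apply_smoothVectorField hX)

theorem h_apply (hY : SmoothVectorField Y) (x : M) (v : TangentSpace (𝓡 n) x) :
    D.h x v (Y x) = D.transversalPart x (mvfderiv (𝓡 n) (D.pushforward Y) x v) :=
  DFunLike.congr_fun (TensorialAt.mkHom_apply (D.tensorialAt_transversalPart x)
    (hY.mdifferentiableAt x)) v

theorem contMDiff_h (hX : SmoothVectorField X) (hY : SmoothVectorField Y) :
    ContMDiff (𝓡 n) 𝓘(ℝ, ℝ) ∞ (fun y ↦ D.h y (X y) (Y y)) := by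
  simp_rw [D.h_apply hY]
  exact D.contMDiff_transversalPart
    ((D.contMDiff_pushforward hY).mvfderiv_apply_smoothVectorField hX)

theorem smoothVectorField_S (hX : SmoothVectorField X) :
    SmoothVectorField (fun y ↦ D.S y (X y)) :=
  (D.smoothVectorField_tangentPart (D.contMDiff_ξ.mvfderiv_apply_smoothVectorField hX)).neg

theorem contMDiff_τ (hX : SmoothVectorField X) :
    ContMDiff (𝓡 n) 𝓘(ℝ, ℝ) ∞ (fun y ↦ D.τ y (X y)) :=
  D.contMDiff_transversalPart (D.contMDiff_ξ.mvfderiv_apply_smoothVectorField hX)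

theorem nabla_add (hY : SmoothVectorField Y) (hZ : SmoothVectorField Z) (x : M) :
    D.nabla (Y + Z) x = D.nabla Y x + D.nabla Z x := by
  have : D.pushforward (Y + Z) = D.pushforward Y + D.pushforward Z := by
    ext1 y; simp [pushforward]
  rw [nabla, this, mvfderiv_add (D.mdifferentiableAt_pushforward (hY.mdifferentiableAt x))
    (D.mdifferentiableAt_pushforward (hZ.mdifferentiableAt x))]
  ext1 v
  simp [nabla]

theorem mvfderiv_pushforward (hY : SmoothVectorField Y) (x : M) (v : TangentSpace (𝓡 n) x) :
    mvfderiv (𝓡 n) (D.pushforward Y) x v =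
      mvfderiv (𝓡 n) D.f x (D.nabla Y x v) + D.h x v (Y x) • D.ξ x := by
  rw [D.h_apply hY]
  exact (D.tangentPart_add_transversalPart x _).symm

theorem pushforward_mlieBracket (hX : SmoothVectorField X) (hY : SmoothVectorField Y) (x : M) :
    mvfderiv (𝓡 n) D.f x (mlieBracket (𝓡 n) X Y x) =
      mvfderiv (𝓡 n) (D.pushforward Y) x (X x) - mvfderiv (𝓡 n) (D.pushforward X) x (Y x) :=
  mvfderiv_mlieBracket D.contMDiff_f hX hY x

/-- The induced connection is torsion-free. -/
theorem nabla_sub_nabla (hX : SmoothVectorField X) (hY : SmoothVectorField Y) (x : M) :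
    D.nabla Y x (X x) - D.nabla X x (Y x) = mlieBracket (𝓡 n) X Y x := by
  have h := congr_arg (D.tangentPart x) (D.pushforward_mlieBracket hX hY x)
  rw [tangentPart_mvfderiv, map_sub] at h
  exact h.symm

/-- D_X f_*Y − D_Y f_*X = f_*[X, Y] is tangent, so its transversal part vanishes. -/
theorem h_symm [T2Space M] (x : M) (v w : TangentSpace (𝓡 n) x) : D.h x v w = D.h x w v := by
  obtain ⟨X, hX, rfl⟩ := exists_smoothVectorField_eq x v
  obtain ⟨Y, hY, rfl⟩ := exists_smoothVectorField_eq x w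
  have h := congr_arg (D.transversalPart x) (D.pushforward_mlieBracket hX hY x)
  rw [transversalPart_mvfderiv, map_sub, ← D.h_apply hY, ← D.h_apply hX] at h
  linarith

/-- The derivative of `f_* V + g ξ`. -/
theorem mvfderiv_pushforward_add_smul {V : ∀ x : M, TangentSpace (𝓡 n) x} {g : M → ℝ}
    (hV : SmoothVectorField V) (hg : ContMDiff (𝓡 n) 𝓘(ℝ, ℝ) ∞ g) (x : M)
    (v : TangentSpace (𝓡 n) x) :
    mvfderiv (𝓡 n) (D.pushforward V + g • D.ξ) x v =
      mvfderiv (𝓡 n) D.f x (D.nabla V x v - g x • D.S x v) +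
        (D.h x v (V x) + g x * D.τ x v + mvfderiv (𝓡 n) g x v) • D.ξ x := by
  have hg' := hg.mdifferentiableAt (x := x) (by simp)
  have hξ := D.contMDiff_ξ.mdifferentiableAt (x := x) (by simp)
  have h1 := mvfderiv_add (D.mdifferentiableAt_pushforward (hV.mdifferentiableAt x))
    (hg'.smul hξ)
  have h2 := congr_arg (fun L ↦ L v) (h1.trans (congr_arg _ (mvfderiv_smul hg' hξ)))
  refine h2.trans ?_
  have h3 := D.mvfderiv_pushforward hV x v
  have h4 := D.weingarten_formula x v
  simp only [add_apply, smul_apply,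
    ContinuousLinearMap.smulRight_apply]
  rw [h3, h4, map_sub, map_smul]
  module

/-- The Gauss equation. -/
theorem gauss_equation (hX : SmoothVectorField X) (hY : SmoothVectorField Y)
    (hZ : SmoothVectorField Z) (x : M) :
    D.nabla (fun y ↦ D.nabla Z y (Y y)) x (X x) - D.nabla (fun y ↦ D.nabla Z y (X y)) x (Y x) -
        D.nabla Z x (mlieBracket (𝓡 n) X Y x) =
      gaussCurvature (D.h x) (D.S x : TangentSpace (𝓡 n) x →ₗ[ℝ] TangentSpace (𝓡 n) x)
        (X x) (Y x) (Z x) := by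
  -- The equation is the tangential part of the flatness of D on f_*Z; the term with S comes from
  -- differentiating ξ in h(W, Z)ξ.
  have key : ∀ W : ∀ x : M, TangentSpace (𝓡 n) x, SmoothVectorField W → ∀ v,
      D.tangentPart x (mvfderiv (𝓡 n) (fun y ↦ mvfderiv (𝓡 n) (D.pushforward Z) y (W y)) x v) =
        D.nabla (fun y ↦ D.nabla Z y (W y)) x v - D.h x (W x) (Z x) • D.S x v := by
    intro W hW v
    have e : (fun y ↦ mvfderiv (𝓡 n) (D.pushforward Z) y (W y)) =
        D.pushforward (fun y ↦ D.nabla Z y (W y)) + (fun y ↦ D.h y (W y) (Z y)) • D.ξ :=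
      funext fun y ↦ D.mvfderiv_pushforward hZ y (W y)
    rw [e, D.mvfderiv_pushforward_add_smul (D.smoothVectorField_nabla hW hZ)
      (D.contMDiff_h hW hZ), map_add, tangentPart_mvfderiv, map_smul, tangentPart_ξ, smul_zero,
      add_zero]
  have h := congr_arg (D.tangentPart x)
    (mvfderiv_mlieBracket (D.contMDiff_pushforward hZ) hX hY x)
  rw [map_sub, key Y hY, key X hX] at h
  have h' : D.nabla Z x (mlieBracket (𝓡 n) X Y x) = _ := h
  rw [h', gaussCurvature_apply]
  simp only [ContinuousLinearMap.coe_coe]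
  module

/-- If `dτ = 0`, then the shape operator is self-adjoint. -/
theorem IsLocallyEquiaffine.h_S [T2Space M] {D : AffineHypersurface n M}
    (hD : D.IsLocallyEquiaffine) (x : M) (v w : TangentSpace (𝓡 n) x) :
    D.h x (D.S x v) w = D.h x v (D.S x w) := by
  obtain ⟨X, hX, rfl⟩ := exists_smoothVectorField_eq x v
  obtain ⟨Y, hY, rfl⟩ := exists_smoothVectorField_eq x w
  -- The identity is the transversal part of the flatness of D on ξ. The products τ(X)τ(Y) cancel,
  -- and dτ = 0 removes the derivatives of τ.
  have key : ∀ W : ∀ x : M, TangentSpace (𝓡 n) x, SmoothVectorField W → ∀ v,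
      D.transversalPart x (mvfderiv (𝓡 n) (fun y ↦ mvfderiv (𝓡 n) D.ξ y (W y)) x v) =
        -D.h x v (D.S x (W x)) + D.τ x (W x) * D.τ x v +
          mvfderiv (𝓡 n) (fun y ↦ D.τ y (W y)) x v := by
    intro W hW v
    have e : (fun y ↦ mvfderiv (𝓡 n) D.ξ y (W y)) =
        D.pushforward (-fun y ↦ D.S y (W y)) + (fun y ↦ D.τ y (W y)) • D.ξ := by
      funext y
      rw [D.weingarten_formula]
      simp [pushforward]
    rw [e, D.mvfderiv_pushforward_add_smul (D.smoothVectorField_S hW).neg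
      (D.contMDiff_τ hW), map_add, transversalPart_mvfderiv, map_smul, transversalPart_ξ]
    simp
  have h := congr_arg (D.transversalPart x) (mvfderiv_mlieBracket D.contMDiff_ξ hX hY x)
  rw [map_sub, key Y hY, key X hX] at h
  have h' : D.τ x (mlieBracket (𝓡 n) X Y x) = _ := h
  have h2 := hD X Y hX hY x
  rw [h', D.h_symm x (Y x)] at h2
  linarith

theorem smoothVectorField_gaussCurvature (hX : SmoothVectorField X) (hY : SmoothVectorField Y)
    (hZ : SmoothVectorField Z) :
    SmoothVectorField (fun x ↦ gaussCurvature (D.h x)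
      (D.S x : TangentSpace (𝓡 n) x →ₗ[ℝ] TangentSpace (𝓡 n) x) (X x) (Y x) (Z x)) := by
  simp_rw [gaussCurvature_apply]
  exact ((D.smoothVectorField_S hX).smul (D.contMDiff_h hY hZ)).sub
    ((D.smoothVectorField_S hY).smul (D.contMDiff_h hX hZ))

end AffineHypersurface

/-! ### Covariant derivatives of operations on vector fields and the Ricci identity -/

section MultiadditiveOperations

variable {n : ℕ} {M : Type*} [TopologicalSpace M]
  [ChartedSpace (EuclideanSpace ℝ (Fin n)) M] [IsManifold (𝓡 n) ∞ M]

/-- The operation `T` maps smooth vector fields to smooth functions and is additive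
in each variable. -/
structure IsSmoothMultiadditive {p : ℕ} (T : (Fin p → ∀ x : M, TangentSpace (𝓡 n) x) → M → ℝ) :
    Prop where
  contMDiff : ∀ Z : Fin p → ∀ x : M, TangentSpace (𝓡 n) x, (∀ i, SmoothVectorField (Z i)) →
    ContMDiff (𝓡 n) 𝓘(ℝ, ℝ) ∞ (T Z)
  update_add : ∀ Z : Fin p → ∀ x : M, TangentSpace (𝓡 n) x, (∀ i, SmoothVectorField (Z i)) →
    ∀ i V W, SmoothVectorField V → SmoothVectorField W → ∀ x,
      T (Function.update Z i (V + W)) x = T (Function.update Z i V) x + T (Function.update Z i W) x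

theorem SmoothVectorField.update {p : ℕ} {Z : Fin p → ∀ x : M, TangentSpace (𝓡 n) x}
    (hZ : ∀ i, SmoothVectorField (Z i)) (j : Fin p) {V : ∀ x : M, TangentSpace (𝓡 n) x}
    (hV : SmoothVectorField V) (i : Fin p) : SmoothVectorField (Function.update Z j V i) := by
  obtain rfl | h := eq_or_ne i j
  · rwa [Function.update_self]
  · rw [Function.update_of_ne h]
    exact hZ i

namespace IsSmoothMultiadditive

variable {p : ℕ} {T : (Fin p → ∀ x : M, TangentSpace (𝓡 n) x) → M → ℝ}
  {Z : Fin p → ∀ x : M, TangentSpace (𝓡 n) x} {V W : ∀ x : M, TangentSpace (𝓡 n) x}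

theorem update_sub (hT : IsSmoothMultiadditive T) (hZ : ∀ i, SmoothVectorField (Z i)) (i : Fin p)
    (hV : SmoothVectorField V) (hW : SmoothVectorField W) (x : M) :
    T (Function.update Z i (V - W)) x =
      T (Function.update Z i V) x - T (Function.update Z i W) x := by
  have := hT.update_add Z hZ i (V - W) W (hV.sub hW) hW x
  rw [sub_add_cancel] at this
  linarith

theorem mdifferentiableAt (hT : IsSmoothMultiadditive T) (hZ : ∀ i, SmoothVectorField (Z i))
    (x : M) : MDifferentiableAt (𝓡 n) 𝓘(ℝ, ℝ) (T Z) x :=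
  (hT.contMDiff Z hZ).mdifferentiableAt (by simp)

variable (D : AffineHypersurface n M)

/-- Smoothness and additivity are all that the Ricci identity requires of T, so it suffices to
propagate these through ∇ instead of linearity over functions. -/
theorem nablaTensor (hT : IsSmoothMultiadditive T) : IsSmoothMultiadditive (D.nablaTensor T) where
  contMDiff Z hZ := by
    have h1 := (hT.contMDiff _ fun i ↦ hZ i.succ).mvfderiv_apply_smoothVectorField (hZ 0)
    have h2 := ContMDiff.sum (t := Finset.univ) fun i _ ↦ hT.contMDiff _
      (SmoothVectorField.update (fun i ↦ hZ i.succ) i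
        (D.smoothVectorField_nabla (hZ 0) (hZ i.succ)))
    exact h1.sub h2
  update_add Z hZ i V W hV hW x := by
    have hZ' : ∀ i, SmoothVectorField (Fin.tail Z i) := fun i ↦ hZ i.succ
    cases i using Fin.cases with
    | zero =>
      have h1 : ∀ (j : Fin p) x, T (Function.update (Fin.tail Z) j
          (fun y ↦ D.nabla (Z j.succ) y ((V + W) y))) x =
          T (Function.update (Fin.tail Z) j (fun y ↦ D.nabla (Z j.succ) y (V y))) x +
            T (Function.update (Fin.tail Z) j (fun y ↦ D.nabla (Z j.succ) y (W y))) x := by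
        intro j x
        refine Eq.trans ?_ (hT.update_add _ hZ' j _ _ (D.smoothVectorField_nabla hV (hZ' j))
          (D.smoothVectorField_nabla hW (hZ' j)) x)
        congr 2
        ext1 y
        exact map_add _ _ _
      have h2 : ∀ U : ∀ x : M, TangentSpace (𝓡 n) x,
          D.nablaTensor T (Function.update Z 0 U) x = mvfderiv (𝓡 n) (T (Fin.tail Z)) x (U x) -
            ∑ j, T (Function.update (Fin.tail Z) j (fun y ↦ D.nabla (Z j.succ) y (U y))) x := by
        intro U
        rfl
      rw [h2, h2, h2, Finset.sum_congr rfl fun j _ ↦ h1 j x, Finset.sum_add_distrib, Pi.add_apply,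
        map_add]
      ring
    | succ i =>
      have h2 : ∀ U : ∀ x : M, TangentSpace (𝓡 n) x,
          D.nablaTensor T (Function.update Z i.succ U) x =
            mvfderiv (𝓡 n) (T (Function.update (Fin.tail Z) i U)) x (Z 0 x) -
            ∑ j, T (Function.update (Function.update (Fin.tail Z) i U) j
              (fun y ↦ D.nabla (Function.update (Fin.tail Z) i U j) y (Z 0 y))) x := by
        intro U
        rw [← Fin.tail_update_succ]
        rfl
      have h3 : ∀ j, T (Function.update (Function.update (Fin.tail Z) i (V + W)) j
              (fun y ↦ D.nabla (Function.update (Fin.tail Z) i (V + W) j) y (Z 0 y))) x =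
          T (Function.update (Function.update (Fin.tail Z) i V) j
              (fun y ↦ D.nabla (Function.update (Fin.tail Z) i V j) y (Z 0 y))) x +
          T (Function.update (Function.update (Fin.tail Z) i W) j
              (fun y ↦ D.nabla (Function.update (Fin.tail Z) i W j) y (Z 0 y))) x := by
        intro j
        obtain rfl | hj := eq_or_ne j i
        · simp only [Function.update_self, Function.update_idem]
          rw [← hT.update_add _ hZ' _ _ _ (D.smoothVectorField_nabla (hZ 0) hV)
            (D.smoothVectorField_nabla (hZ 0) hW)]
          congr 2
          ext1 y
          rw [D.nabla_add hV hW]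
          rfl
        · simp only [Function.update_of_ne hj, Function.update_comm hj.symm]
          exact hT.update_add _ (SmoothVectorField.update hZ' _
            (D.smoothVectorField_nabla (hZ 0) (hZ' j))) _ _ _ hV hW x
      have h4 : T (Function.update (Fin.tail Z) i (V + W)) =
          T (Function.update (Fin.tail Z) i V) + T (Function.update (Fin.tail Z) i W) :=
        funext fun y ↦ hT.update_add _ hZ' _ _ _ hV hW y
      rw [h2, h2, h2, Finset.sum_congr rfl fun j _ ↦ h3 j, Finset.sum_add_distrib, h4,
        mvfderiv_add (hT.mdifferentiableAt (SmoothVectorField.update hZ' i hV) x)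
          (hT.mdifferentiableAt (SmoothVectorField.update hZ' i hW) x), add_apply]
      ring

theorem iteratedNabla (hT : IsSmoothMultiadditive T) :
    ∀ k, IsSmoothMultiadditive (D.iteratedNabla T k)
  | 0 => hT
  | k + 1 => (iteratedNabla hT k).nablaTensor D

end IsSmoothMultiadditive

namespace AffineHypersurface

variable (D : AffineHypersurface n M) {p : ℕ}
  {T : (Fin p → ∀ x : M, TangentSpace (𝓡 n) x) → M → ℝ}
  {X Y : ∀ x : M, TangentSpace (𝓡 n) x} {Z : Fin p → ∀ x : M, TangentSpace (𝓡 n) x}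

theorem nablaTensor_vecCons (T : (Fin p → ∀ x : M, TangentSpace (𝓡 n) x) → M → ℝ)
    (X : ∀ x : M, TangentSpace (𝓡 n) x) (Z : Fin p → ∀ x : M, TangentSpace (𝓡 n) x) (x : M) :
    D.nablaTensor T (Matrix.vecCons X Z) x = mvfderiv (𝓡 n) (T Z) x (X x) -
      ∑ i, T (Function.update Z i (fun y ↦ D.nabla (Z i) y (X y))) x :=
  rfl

theorem nablaTensor_nablaTensor_vecCons (hT : IsSmoothMultiadditive T)
    (hY : SmoothVectorField Y) (hZ : ∀ i, SmoothVectorField (Z i)) (x : M) :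
    D.nablaTensor (D.nablaTensor T) (Matrix.vecCons X (Matrix.vecCons Y Z)) x =
      mvfderiv (𝓡 n) (fun y ↦ mvfderiv (𝓡 n) (T Z) y (Y y)) x (X x) -
        mvfderiv (𝓡 n) (T Z) x (D.nabla Y x (X x)) -
        ∑ i, mvfderiv (𝓡 n)
          (T (Function.update Z i (fun y ↦ D.nabla (Z i) y (Y y)))) x (X x) -
        ∑ i, mvfderiv (𝓡 n)
          (T (Function.update Z i (fun y ↦ D.nabla (Z i) y (X y)))) x (Y x) +
        ∑ i, T (Function.update Z i (fun y ↦ D.nabla (Z i) y (D.nabla Y y (X y)))) x +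
        ∑ i, ∑ j, T (Function.update (Function.update Z i (fun y ↦ D.nabla (Z i) y (X y))) j
          (fun y ↦ D.nabla (Function.update Z i (fun y ↦ D.nabla (Z i) y (X y)) j) y (Y y))) x := by
  have hd : ∀ i, MDifferentiableAt (𝓡 n) 𝓘(ℝ, ℝ)
      (T (Function.update Z i (fun y ↦ D.nabla (Z i) y (Y y)))) x := fun i ↦
    hT.mdifferentiableAt (SmoothVectorField.update hZ i (D.smoothVectorField_nabla hY (hZ i))) x
  have h1 : mvfderiv (𝓡 n) (D.nablaTensor T (Matrix.vecCons Y Z)) x (X x) =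
      mvfderiv (𝓡 n) (fun y ↦ mvfderiv (𝓡 n) (T Z) y (Y y)) x (X x) - ∑ i, mvfderiv (𝓡 n)
          (T (Function.update Z i (fun y ↦ D.nabla (Z i) y (Y y)))) x (X x) := by
    have e : D.nablaTensor T (Matrix.vecCons Y Z) = (fun y ↦ mvfderiv (𝓡 n) (T Z) y (Y y)) -
        ∑ i, T (Function.update Z i (fun y ↦ D.nabla (Z i) y (Y y))) := by
      ext1 y
      rw [nablaTensor_vecCons, Pi.sub_apply, Finset.sum_apply]
    have hs : ∀ s : Finset (Fin p), MDifferentiableAt (𝓡 n) 𝓘(ℝ, ℝ)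
        (∑ i ∈ s, T (Function.update Z i (fun y ↦ D.nabla (Z i) y (Y y)))) x ∧
        mvfderiv (𝓡 n) (∑ i ∈ s, T (Function.update Z i (fun y ↦ D.nabla (Z i) y (Y y)))) x (X x)
          = ∑ i ∈ s, mvfderiv (𝓡 n)
            (T (Function.update Z i (fun y ↦ D.nabla (Z i) y (Y y)))) x (X x) := by
      intro s
      induction s using Finset.cons_induction with
      | empty => exact ⟨mdifferentiableAt_const, by simp⟩
      | cons i s hi ih =>
        rw [Finset.sum_cons, Finset.sum_cons]
        exact ⟨(hd i).add ih.1, by rw [mvfderiv_add (hd i) ih.1, add_apply, ih.2]⟩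
    rw [e, mvfderiv_sub (((hT.contMDiff Z hZ).mvfderiv_apply_smoothVectorField
      hY).mdifferentiableAt (by simp)) (hs _).1, sub_apply, (hs _).2]
  have h3 : ∀ i : Fin p, D.nablaTensor T (Function.update (Matrix.vecCons Y Z) i.succ
      (fun y ↦ D.nabla (Matrix.vecCons Y Z i.succ) y (X y))) x = _ := fun i ↦
    (congr_arg (fun V ↦ D.nablaTensor T V x) (Fin.cons_update _ _ _ _).symm).trans
      (D.nablaTensor_vecCons T Y (Function.update Z i (fun y ↦ D.nabla (Z i) y (X y))) x)
  have h2 : D.nablaTensor T (Function.update (Matrix.vecCons Y Z) 0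
      (fun y ↦ D.nabla (Matrix.vecCons Y Z 0) y (X y))) x = _ :=
    (congr_arg (fun V ↦ D.nablaTensor T V x) (Fin.update_cons_zero _ _ _)).trans
      (D.nablaTensor_vecCons T (fun y ↦ D.nabla Y y (X y)) Z x)
  rw [nablaTensor_vecCons, h1, Fin.sum_univ_succ, h2, Finset.sum_congr rfl fun i _ ↦ h3 i,
    Finset.sum_sub_distrib]
  ring

/-- The Ricci identity. -/
theorem nablaTensor_nablaTensor_sub (hT : IsSmoothMultiadditive T) (hX : SmoothVectorField X)
    (hY : SmoothVectorField Y) (hZ : ∀ i, SmoothVectorField (Z i)) (x : M) :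
    D.nablaTensor (D.nablaTensor T) (Matrix.vecCons X (Matrix.vecCons Y Z)) x -
        D.nablaTensor (D.nablaTensor T) (Matrix.vecCons Y (Matrix.vecCons X Z)) x =
      -∑ i, T (Function.update Z i (fun y ↦ gaussCurvature (D.h y)
        (D.S y : TangentSpace (𝓡 n) y →ₗ[ℝ] TangentSpace (𝓡 n) y) (X y) (Y y) (Z i y))) x := by
  set F : (∀ x : M, TangentSpace (𝓡 n) x) → (∀ x : M, TangentSpace (𝓡 n) x) →
      Fin p → Fin p → ℝ := fun X Y i j ↦
    T (Function.update (Function.update Z i (fun y ↦ D.nabla (Z i) y (X y))) j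
      (fun y ↦ D.nabla (Function.update Z i (fun y ↦ D.nabla (Z i) y (X y)) j) y (Y y))) x
    with hF
  -- Terms with ∇_X and ∇_Y in different slots are symmetric and cancel; only i = j survives.
  have hsum : ∑ i, ∑ j, F X Y i j - ∑ i, ∑ j, F Y X i j = ∑ i, (F X Y i i - F Y X i i) := by
    rw [Finset.sum_comm (f := F Y X), ← Finset.sum_sub_distrib]
    refine Finset.sum_congr rfl fun i _ ↦ ?_
    rw [← Finset.sum_sub_distrib, Finset.sum_eq_single i _ (by simp)]
    intro j _ hj
    simp only [hF, Function.update_of_ne hj, Function.update_of_ne hj.symm,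
      Function.update_comm hj, sub_self]
  have hdiag : ∀ X Y i, F X Y i i = T (Function.update Z i
      (fun y ↦ D.nabla (fun y ↦ D.nabla (Z i) y (X y)) y (Y y))) x := fun X Y i ↦ by
    simp only [hF, Function.update_self, Function.update_idem]
  -- The Gauss equation expresses R(X, Y)Zᵢ by iterated ∇, with ∇ along [X, Y] split by
  -- torsion-freeness; additivity of T separates the four terms.
  have hR : ∀ i, T (Function.update Z i (fun y ↦ gaussCurvature (D.h y)
        (D.S y : TangentSpace (𝓡 n) y →ₗ[ℝ] TangentSpace (𝓡 n) y) (X y) (Y y) (Z i y))) x =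
      F Y X i i - F X Y i i -
        (T (Function.update Z i (fun y ↦ D.nabla (Z i) y (D.nabla Y y (X y)))) x -
          T (Function.update Z i (fun y ↦ D.nabla (Z i) y (D.nabla X y (Y y)))) x) := by
    intro i
    have hXY := D.smoothVectorField_nabla hX hY
    have hYX := D.smoothVectorField_nabla hY hX
    have hXZ := D.smoothVectorField_nabla hX (hZ i)
    have hYZ := D.smoothVectorField_nabla hY (hZ i)
    rw [hdiag, hdiag, ← hT.update_sub hZ i (D.smoothVectorField_nabla hXY (hZ i))
      (D.smoothVectorField_nabla hYX (hZ i)),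
      ← hT.update_sub hZ i (D.smoothVectorField_nabla hX hYZ) (D.smoothVectorField_nabla hY hXZ),
      ← hT.update_sub hZ i ((D.smoothVectorField_nabla hX hYZ).sub
        (D.smoothVectorField_nabla hY hXZ)) ((D.smoothVectorField_nabla hXY (hZ i)).sub
        (D.smoothVectorField_nabla hYX (hZ i)))]
    congr 2
    ext1 y
    rw [← D.gauss_equation hX hY (hZ i), ← D.nabla_sub_nabla hX hY, map_sub]
    rfl
  have hfun := mvfderiv_mlieBracket (hT.contMDiff Z hZ) hX hY x
  rw [← D.nabla_sub_nabla hX hY, map_sub] at hfun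
  rw [D.nablaTensor_nablaTensor_vecCons hT hY hZ, D.nablaTensor_nablaTensor_vecCons hT hX hZ,
    Finset.sum_congr rfl fun i _ ↦ hR i]
  simp only [Finset.sum_sub_distrib] at hsum ⊢
  linarith

end AffineHypersurface

end MultiadditiveOperations

namespace AlmostSymplecticForm

variable {n : ℕ} {M : Type*} [TopologicalSpace M]
  [ChartedSpace (EuclideanSpace ℝ (Fin n)) M] [IsManifold (𝓡 n) ∞ M]
  (Ω : AlmostSymplecticForm n M)

theorem contMDiff_apply {X Y : ∀ x : M, TangentSpace (𝓡 n) x} (hX : SmoothVectorField X)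
    (hY : SmoothVectorField Y) : ContMDiff (𝓡 n) 𝓘(ℝ, ℝ) ∞ (fun x ↦ Ω.toFun x (X x) (Y x)) := by
  have h : ContMDiff (𝓡 n) ((𝓡 n).prod 𝓘(ℝ)) ∞
      (fun x ↦ TotalSpace.mk' ℝ (E := Bundle.Trivial M ℝ) x (Ω.toFun x (X x) (Y x))) :=
    ContMDiff.clm_bundle_apply₂ (F₁ := EuclideanSpace ℝ (Fin n)) (F₂ := EuclideanSpace ℝ (Fin n))
      Ω.contMDiff hX hY
  intro x
  have h1 := h x
  simp only [contMDiffAt_totalSpace] at h1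
  exact h1.2

theorem isSmoothMultiadditive_onFields : IsSmoothMultiadditive Ω.onFields where
  contMDiff Z hZ := Ω.contMDiff_apply (hZ 0) (hZ 1)
  update_add Z hZ i V W hV hW x := by
    fin_cases i <;> simp [onFields]

/-- The form at a point as a bilinear map. -/
noncomputable def bilin (x : M) : TangentSpace (𝓡 n) x →ₗ[ℝ] TangentSpace (𝓡 n) x →ₗ[ℝ] ℝ :=
  ContinuousLinearMap.coeLM ℝ ∘ₗ (Ω.toFun x).toLinearMap

end AlmostSymplecticForm

/-! ### From ∇ᵏω = 0 to Rᵏ · ω = 0 -/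

namespace AffineHypersurface

variable {n : ℕ} {M : Type*} [TopologicalSpace M]
  [ChartedSpace (EuclideanSpace ℝ (Fin n)) M] [IsManifold (𝓡 n) ∞ M]
  (D : AffineHypersurface n M)

/-- The iterated curvature action on `Ω` is a combination of index permutations of an iterated
covariant derivative. -/
theorem exists_iteratedCurvatureAction_eq_sum (Ω : AlmostSymplecticForm n M) (p : ℕ) :
    ∃ (ι : Type) (_ : Fintype ι) (c : ι → ℝ) (σ : ι → Fin (2 + 2 * p) → Fin (2 + 2 * p)),
      (∀ a, Function.Bijective (σ a)) ∧
      ∀ Z : Fin (2 + 2 * p) → ∀ x : M, TangentSpace (𝓡 n) x, (∀ i, SmoothVectorField (Z i)) →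
        ∀ x, iteratedCurvatureAction (D.h x)
            (D.S x : TangentSpace (𝓡 n) x →ₗ[ℝ] TangentSpace (𝓡 n) x)
            (tensorOfBilin (Ω.bilin x)) p (fun i ↦ Z i x) =
          ∑ a, c a * D.iteratedNabla Ω.onFields (2 * p) (fun i ↦ Z (σ a i)) x := by
  induction p with
  | zero =>
    refine ⟨Unit, inferInstance, fun _ ↦ 1, fun _ ↦ id, fun _ ↦ Function.bijective_id,
      fun Z hZ x ↦ ?_⟩
    simp only [Finset.univ_unique, Finset.sum_singleton, one_mul]
    rfl
  | succ p ih =>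
    obtain ⟨ι, _, c, σ, hσ, h⟩ := ih
    let T := D.iteratedNabla Ω.onFields (2 * p)
    have hT : IsSmoothMultiadditive T := Ω.isSmoothMultiadditive_onFields.iteratedNabla D _
    let lift (a : ι) : Fin (2 + 2 * p) → Fin (2 + 2 * p + 1 + 1) := fun i ↦ (σ a i).succ.succ
    -- The Ricci identity doubles the index set: `true` keeps the two new slots in order, `false`
    -- swaps them and carries the opposite sign.
    let s : ι × Bool → Fin (2 + 2 * p + 1 + 1) → Fin (2 + 2 * p + 1 + 1) := fun a ↦
      bif a.2 then Matrix.vecCons 0 (Matrix.vecCons 1 (lift a.1))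
        else Matrix.vecCons 1 (Matrix.vecCons 0 (lift a.1))
    refine ⟨ι × Bool, inferInstance, fun a ↦ bif a.2 then c a.1 else -c a.1, s, ?_, ?_⟩
    · have hinj : ∀ a i j, lift a i = lift a j → i = j := fun a i j hij ↦
        (hσ a).1 (Fin.succ_injective _ (Fin.succ_injective _ hij))
      rintro ⟨a, b⟩
      refine Finite.injective_iff_bijective.1 fun i j ↦ ?_
      have h10 : ∀ k : Fin (2 + 2 * p), (1 : Fin (2 + 2 * p + 1 + 1)) ≠ k.succ.succ := fun k hk ↦
        (Fin.succ_ne_zero k) (Fin.succ_injective _ hk.symm)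
      have h00 : ∀ k : Fin (2 + 2 * p), (0 : Fin (2 + 2 * p + 1 + 1)) ≠ k.succ.succ := fun k ↦
        (Fin.succ_ne_zero _).symm
      cases b <;>
      · refine Fin.cases ?_ (fun i ↦ Fin.cases ?_ (fun i ↦ ?_) i) i <;>
        refine Fin.cases ?_ (fun j ↦ Fin.cases ?_ (fun j ↦ ?_) j) j <;>
        simp [s, lift, h10, h00, (h10 _).symm, (h00 _).symm, (hσ a).1.eq_iff]
    · intro Z hZ x
      let W : Fin (2 + 2 * p) → ∀ x : M, TangentSpace (𝓡 n) x := fun i ↦ Z i.succ.succ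
      have hW : ∀ i, SmoothVectorField (W i) := fun i ↦ hZ _
      let R (V : ∀ x : M, TangentSpace (𝓡 n) x) : ∀ x : M, TangentSpace (𝓡 n) x := fun y ↦
        gaussCurvature (D.h y) (D.S y : TangentSpace (𝓡 n) y →ₗ[ℝ] TangentSpace (𝓡 n) y)
          (Z 0 y) (Z 1 y) (V y)
      have h1 : ∀ i, iteratedCurvatureAction (D.h x)
            (D.S x : TangentSpace (𝓡 n) x →ₗ[ℝ] TangentSpace (𝓡 n) x)
            (tensorOfBilin (Ω.bilin x)) p
            (Function.update (fun j ↦ W j x) i (R (W i) x)) =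
          ∑ a, c a * T (fun j ↦ Function.update W i (R (W i)) (σ a j)) x := by
        intro i
        rw [← h _ (SmoothVectorField.update hW i
          (D.smoothVectorField_gaussCurvature (hZ 0) (hZ 1) (hW i)))]
        congr 1
        ext1 j
        obtain rfl | hj := eq_or_ne j i
        · simp only [Function.update_self]
          rfl
        · simp only [Function.update_of_ne hj]
      -- Bijectivity of σ a lets the sum over slots of W be reindexed as a sum over slots of the
      -- permuted family, which is the shape in the Ricci identity.
      have h2 : ∀ a, ∑ i, T (fun j ↦ Function.update W i (R (W i)) (σ a j)) x =
          ∑ i, T (Function.update (fun j ↦ W (σ a j)) i (R (W (σ a i)))) x := by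
        intro a
        refine ((Equiv.ofBijective _ (hσ a)).sum_comp _).symm.trans
          (Finset.sum_congr rfl fun i _ ↦ ?_)
        congr 1
        ext1 j
        obtain rfl | hj := eq_or_ne j i
        · simp
        · rw [Function.update_of_ne hj, Function.update_of_ne]
          exact fun e ↦ hj ((hσ a).1 e)
      have h3 : ∀ a, ∑ i, T (Function.update (fun j ↦ W (σ a j)) i (R (W (σ a i)))) x =
          -(D.nablaTensor (D.nablaTensor T) (fun i ↦ Z (s (a, true) i)) x -
            D.nablaTensor (D.nablaTensor T) (fun i ↦ Z (s (a, false) i)) x) := by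
        intro a
        have e : ∀ (i j : Fin (2 + 2 * p + 1 + 1)) (f : Fin (2 + 2 * p) → Fin (2 + 2 * p + 1 + 1)),
            (fun k ↦ Z (Matrix.vecCons i (Matrix.vecCons j f) k)) =
            Matrix.vecCons (Z i) (Matrix.vecCons (Z j) (fun k ↦ Z (f k))) := by
          intro i j f
          ext1 k
          refine Fin.cases ?_ (fun k ↦ Fin.cases ?_ (fun k ↦ ?_) k) k <;> rfl
        have e1 : (fun i ↦ Z (s (a, true) i)) = _ := e 0 1 (lift a)
        have e2 : (fun i ↦ Z (s (a, false) i)) = _ := e 1 0 (lift a)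
        rw [e1, e2, D.nablaTensor_nablaTensor_sub hT (hZ 0) (hZ 1) (fun i ↦ hZ _), neg_neg]
      have h4 : iteratedCurvatureAction (D.h x)
            (D.S x : TangentSpace (𝓡 n) x →ₗ[ℝ] TangentSpace (𝓡 n) x)
            (tensorOfBilin (Ω.bilin x)) (p + 1) (fun i ↦ Z i x) = _ :=
        curvatureAction_apply _ _ _ _
      rw [h4, derivationAction_apply]
      refine (congr_arg Neg.neg ((Finset.sum_congr rfl fun i _ ↦ h1 i).trans
        Finset.sum_comm)).trans ?_
      simp_rw [← Finset.mul_sum, h2, h3]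
      rw [Fintype.sum_prod_type, ← Finset.sum_neg_distrib]
      refine Finset.sum_congr rfl fun a _ ↦ ?_
      rw [Fintype.sum_bool]
      change _ = c a * D.nablaTensor (D.nablaTensor T) (fun i ↦ Z (s (a, true) i)) x +
        -c a * D.nablaTensor (D.nablaTensor T) (fun i ↦ Z (s (a, false) i)) x
      ring

theorem iteratedNabla_eq_zero_of_le {p : ℕ}
    (T : (Fin p → ∀ x : M, TangentSpace (𝓡 n) x) → M → ℝ) {k : ℕ}
    (hk : ∀ X : Fin (p + k) → ∀ x : M, TangentSpace (𝓡 n) x,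
      (∀ i, SmoothVectorField (X i)) → ∀ x : M, D.iteratedNabla T k X x = 0) {m : ℕ} (hm : k ≤ m) :
    ∀ X : Fin (p + m) → ∀ x : M, TangentSpace (𝓡 n) x,
      (∀ i, SmoothVectorField (X i)) → ∀ x : M, D.iteratedNabla T m X x = 0 := by
  induction m, hm using Nat.le_induction with
  | base => exact hk
  | succ m hm ih =>
    intro X hX x
    have h0 : D.iteratedNabla T m (fun i ↦ X i.succ) = 0 :=
      funext fun y ↦ ih _ (fun i ↦ hX _) y
    change D.nablaTensor (D.iteratedNabla T m) X x = 0
    have h1 := Finset.sum_eq_zero (s := Finset.univ) fun i _ ↦ ih _ (SmoothVectorField.update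
      (fun j ↦ hX j.succ) i (D.smoothVectorField_nabla (hX 0) (hX i.succ))) x
    rw [nablaTensor, h0, mvfderiv_zero]
    exact (congr_arg _ h1).trans (by simp)

/-- Rᵏ · ω involves only ∇²ᵏω, which vanishes with ∇ᵏω because k ≤ 2k. Tangent vectors are extended
to smooth fields to apply this. -/
theorem iteratedCurvatureAction_eq_zero [T2Space M] (Ω : AlmostSymplecticForm n M) {k : ℕ}
    (hpar : ∀ X : Fin (2 + k) → ∀ x : M, TangentSpace (𝓡 n) x,
      (∀ i, SmoothVectorField (X i)) → ∀ x : M, D.iteratedNabla Ω.onFields k X x = 0) (x : M) :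
    iteratedCurvatureAction (D.h x) (D.S x : TangentSpace (𝓡 n) x →ₗ[ℝ] TangentSpace (𝓡 n) x)
      (tensorOfBilin (Ω.bilin x)) k = 0 := by
  ext v
  choose X hX hXv using fun i ↦ exists_smoothVectorField_eq x (v i)
  obtain ⟨ι, _, c, σ, -, h⟩ := D.exists_iteratedCurvatureAction_eq_sum Ω k
  have h1 := h X hX x
  simp only [hXv] at h1
  rw [h1]
  refine Finset.sum_eq_zero fun a _ ↦ ?_
  rw [D.iteratedNabla_eq_zero_of_le Ω.onFields hpar (by omega) _ (fun i ↦ hX _), mul_zero]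

end AffineHypersurface

theorem mainTheorem2 {M : Type*} [TopologicalSpace M]
    [ChartedSpace (EuclideanSpace ℝ (Fin 4)) M] [IsManifold (𝓡 4) ∞ M]
    [T2Space M] [SecondCountableTopology M]
    (D : AffineHypersurface 4 M) (hnondeg : D.IsNondegenerate)
    (hequi : D.IsLocallyEquiaffine) (hLor : D.IsLorentzian)
    (Ω : AlmostSymplecticForm 4 M) (k : ℕ) (hk : 1 ≤ k)
    (hpar : ∀ X : Fin (2 + k) → ∀ x : M, TangentSpace (𝓡 4) x,
      (∀ i, SmoothVectorField (X i)) → ∀ x : M, D.iteratedNabla Ω.onFields k X x = 0) :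
    ∀ x : M, Module.finrank ℝ (LinearMap.range (D.S x).toLinearMap) ≤ 1 := by
  intro x
  have : FiniteDimensional ℝ (TangentSpace (𝓡 4) x) :=
    inferInstanceAs (FiniteDimensional ℝ (EuclideanSpace ℝ (Fin 4)))
  have dim : Module.finrank ℝ (TangentSpace (𝓡 4) x) = 4 := finrank_euclideanSpace_fin
  exact finrank_range_shape_le_one dim (D.h_symm x) (hnondeg x) (hequi.h_S x)
    (by have := (hLor x).1; unfold AffineHypersurface.quadraticForm at this; omega)
    (Ω := Ω.bilin x) (Ω.alternating x) (Ω.nondegenerate x) k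
    (D.iteratedCurvatureAction_eq_zero Ω hpar x)
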